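/- For a group $G$ write $[x,y]=xyx^{-1}y^{-1}$, and let $\langle G,G\rangle$ be the free group on all pairs $\langle x,y\rangle$ with $x,y\in G$. Let $Z(G)$ be the kernel of the homomorphism $\langle G,G\rangle\to[G,G]$, $\langle x,y\rangle\mapsto[x,y]$, and let $B(G)$ be the normal subgroup of $\langle G,G\rangle$ generated by the relations $$\langle x,x\rangle\sim 1,\quad \langle x,y\rangle\sim\langle y,x\rangle^{-1},\quad \langle xy,z\rangle\sim\langle y,z\rangle^{x}\langle x,z\rangle,\quad \langle y,z\rangle^{x}\sim\langle x,[y,z]\rangle\langle y,z\rangle$$ for $x,y,z\in G$, where $\langle y,z\rangle^{x}=\langle xyx^{-1},xzx^{-1}\rangle$. Then $B(G)\subseteq Z(G)$, and the Schur multiplier of $G$ is $\mathcal M(G)=Z(G)/B(G)$. If $x,y\in G$ commute, then $\langle x,y\rangle$ represents an element of $\mathcal M(G)$. Let $n\ge 4$, let $S_n$ and $A_n$ be the symmetric and the alternating group, and let $u\in\mathcal M(S_n)$ be the class of $\langle(1,2),(3,4)\rangle$. 1. The class of $\langle(1,2)(3,4),(1,3)(2,4)\rangle$ is nontrivial in $\mathcal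 M(A_n)$. 2. The class of $\langle(1,2)(3,4),(1,3)(2,4)\rangle$ in $\mathcal M(S_n)$ equals $u$; this class is the image of the element in (1) under the homomorphism $\mathcal M(A_n)\to\mathcal M(S_n)$ induced by the inclusion $A_n\subset S_n$, and it is nontrivial. 3. If $n\notin\{6,7\}$, then the class of $\langle(1,2)(3,4),(1,3)(2,4)\rangle$ generates $\mathcal M(A_n)$, and $\mathcal M(A_n)\cong\mathbb Z_2$. -/

import Mathlib

open scoped commutatorElement

/-- The natural homomorphism from the free group `⟨G, G⟩` on all pairs `⟨x, y⟩` of elements of `G`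
to `G`, with `⟨x, y⟩ ↦ [x, y] = x y x⁻¹ y⁻¹`. Its range is the commutator subgroup `[G, G]`. -/
def pairCommutator (G : Type*) [Group G] : FreeGroup (G × G) →* G :=
  FreeGroup.lift fun p => ⁅p.1, p.2⁆

/-- The generator `⟨x, y⟩` of the free group `⟨G, G⟩`. -/
def pairGen {G : Type*} (x y : G) : FreeGroup (G × G) := FreeGroup.of (x, y)

/-- `Z(G)`: the kernel of the natural homomorphism from `⟨G, G⟩` onto `[G, G]`. -/
def pairCycles (G : Type*) [Group G] : Subgroup (FreeGroup (G × G)) :=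
  (pairCommutator G).ker

/-- The four families of relators `r s⁻¹`, one for each relation `r ∼ s`. Here
`⟨y, z⟩ ^ x` stands for `⟨x y x⁻¹, x z x⁻¹⟩`. -/
inductive PairRelator (G : Type*) [Group G] : FreeGroup (G × G) → Prop
  /-- `⟨x, x⟩ ∼ 1` -/
  | diag (x : G) : PairRelator G (pairGen x x)
  /-- `⟨x, y⟩ ∼ ⟨y, x⟩⁻¹` -/
  | antisymm (x y : G) :
      PairRelator G (pairGen x y * ((pairGen y x)⁻¹)⁻¹)
  /-- `⟨x y, z⟩ ∼ ⟨y, z⟩ ^ x ⟨x, z⟩` -/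
  | mul_left (x y z : G) :
      PairRelator G (pairGen (x * y) z *
        (pairGen (x * y * x⁻¹) (x * z * x⁻¹) * pairGen x z)⁻¹)
  /-- `⟨y, z⟩ ^ x ∼ ⟨x, [y, z]⟩ ⟨y, z⟩` -/
  | conj (x y z : G) :
      PairRelator G (pairGen (x * y * x⁻¹) (x * z * x⁻¹) *
        (pairGen x ⁅y, z⁆ * pairGen y z)⁻¹)

/-- `B(G)`: the normal subgroup of `⟨G, G⟩` generated by the four relations. -/
def pairBoundaries (G : Type*) [Group G] : Subgroup (FreeGroup (G × G)) :=
  Subgroup.normalClosure {w | PairRelator G w}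

instance pairBoundaries_normal (G : Type*) [Group G] : (pairBoundaries G).Normal :=
  Subgroup.normalClosure_normal

/-- `B(G)` is contained in `Z(G)`. -/
theorem pairBoundaries_le_pairCycles (G : Type*) [Group G] :
    pairBoundaries G ≤ pairCycles G := by
  refine Subgroup.normalClosure_le_normal (N := (pairCommutator G).ker) ?_
  rintro w (x | ⟨x, y⟩ | ⟨x, y, z⟩ | ⟨x, y, z⟩) <;>
    simp [MonoidHom.mem_ker, pairCommutator, pairGen, commutatorElement_def, mul_assoc]

/-- The Schur multiplier `M(G) = Z(G) / B(G)`. -/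
abbrev SchurMultiplier (G : Type*) [Group G] : Type _ :=
  pairCycles G ⧸ (pairBoundaries G).subgroupOf (pairCycles G)

theorem pairGen_mem_pairCycles {G : Type*} [Group G] {x y : G} (h : Commute x y) :
    pairGen x y ∈ pairCycles G := by
  simpa [pairCycles, MonoidHom.mem_ker, pairCommutator, pairGen] using
    commutatorElement_eq_one_iff_commute.2 h

/-- For commuting `x` and `y`, the element of `M(G)` represented by `⟨x, y⟩`. -/
def schurClass {G : Type*} [Group G] (x y : G) (h : Commute x y) : SchurMultiplier G :=
  QuotientGroup.mk ⟨pairGen x y, pairGen_mem_pairCycles h⟩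

/-- The homomorphism `⟨G, G⟩ → ⟨H, H⟩` induced by a group homomorphism `f : G → H`. -/
def pairMap {G H : Type*} [Group G] [Group H] (f : G →* H) :
    FreeGroup (G × G) →* FreeGroup (H × H) :=
  FreeGroup.map (Prod.map f f)

@[simp] theorem pairMap_pairGen {G H : Type*} [Group G] [Group H] (f : G →* H) (x y : G) :
    pairMap f (pairGen x y) = pairGen (f x) (f y) := by
  simp [pairMap, pairGen]

theorem pairCommutator_pairMap {G H : Type*} [Group G] [Group H] (f : G →* H)
    (w : FreeGroup (G × G)) :
    pairCommutator H (pairMap f w) = f (pairCommutator G w) := by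
  have h : (pairCommutator H).comp (pairMap f) = f.comp (pairCommutator G) := by
    ext p
    simp [pairCommutator, pairMap, map_commutatorElement]
  exact DFunLike.congr_fun h w

theorem pairMap_mem_pairCycles {G H : Type*} [Group G] [Group H] (f : G →* H)
    (w : pairCycles G) : pairMap f w ∈ pairCycles H := by
  have hw : pairCommutator G w = 1 := w.2
  simp [pairCycles, MonoidHom.mem_ker, pairCommutator_pairMap, hw]

theorem pairBoundaries_le_comap {G H : Type*} [Group G] [Group H] (f : G →* H) :
    pairBoundaries G ≤ (pairBoundaries H).comap (pairMap f) := by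
  refine Subgroup.normalClosure_le_normal ?_
  rintro w hw
  refine Subgroup.subset_normalClosure ?_
  rcases hw with x | ⟨x, y⟩ | ⟨x, y, z⟩ | ⟨x, y, z⟩
  · simpa using PairRelator.diag (f x)
  · simpa using PairRelator.antisymm (f x) (f y)
  · simpa using PairRelator.mul_left (f x) (f y) (f z)
  · simpa [map_commutatorElement] using PairRelator.conj (f x) (f y) (f z)

/-- The homomorphism `M(G) → M(H)` induced by a group homomorphism `f : G → H`. -/
def SchurMultiplier.map {G H : Type*} [Group G] [Group H] (f : G →* H) :
    SchurMultiplier G →* SchurMultiplier H :=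
  QuotientGroup.map _ _
    (((pairMap f).comp (pairCycles G).subtype).codRestrict (pairCycles H)
      (pairMap_mem_pairCycles f))
    (fun _ hw => pairBoundaries_le_comap f hw)

section Permutations

variable {n : ℕ} (hn : 4 ≤ n)

/-- The transposition `(i, j)` in `S_n`, `n ≥ 4`, for `i, j` among the first four points. The points
`1, 2, 3, 4` are the elements `0, 1, 2, 3` of `Fin n`. -/
def transp (i j : Fin 4) : Equiv.Perm (Fin n) :=
  Equiv.swap (Fin.castLE hn i) (Fin.castLE hn j)

/-- `(1,2)(3,4)` in `A_n`. -/
def dblA : alternatingGroup (Fin n) :=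
  ⟨transp hn 0 1 * transp hn 2 3, by
    simp [Equiv.Perm.mem_alternatingGroup, transp, Equiv.Perm.sign_swap']⟩

/-- `(1,3)(2,4)` in `A_n`. -/
def dblB : alternatingGroup (Fin n) :=
  ⟨transp hn 0 2 * transp hn 1 3, by
    simp [Equiv.Perm.mem_alternatingGroup, transp, Equiv.Perm.sign_swap']⟩

theorem transp_commute : Commute (transp hn 0 1) (transp hn 2 3) := by
  refine Equiv.Perm.Disjoint.commute ?_
  apply Equiv.Perm.disjoint_swap_swap
  simp

theorem dbl_commute : Commute (dblA hn) (dblB hn) := by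
  refine Subtype.ext (Eq.symm ?_)
  have h (f : Equiv.Perm (Fin n)) (i j k l : Fin 4)
      (hi : f (Fin.castLE hn i) = Fin.castLE hn k) (hj : f (Fin.castLE hn j) = Fin.castLE hn l) :
      f * transp hn i j = transp hn k l * f := by
    rw [transp, Equiv.mul_swap_eq_swap_mul, hi, hj, transp]
  have hB (i j : Fin 4) (hij : (Equiv.swap 0 2 * Equiv.swap 1 3 : Equiv.Perm (Fin 4)) i = j) :
      (transp hn 0 2 * transp hn 1 3) (Fin.castLE hn i) = Fin.castLE hn j := by
    simp only [transp, Equiv.Perm.mul_apply] at hij ⊢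
    rw [← (Fin.castLE_injective hn).map_swap, ← (Fin.castLE_injective hn).map_swap, hij]
  change (transp hn 0 2 * transp hn 1 3) * (transp hn 0 1 * transp hn 2 3) =
    (transp hn 0 1 * transp hn 2 3) * (transp hn 0 2 * transp hn 1 3)
  rw [← mul_assoc, h _ 0 1 2 3 (hB 0 2 (by decide)) (hB 1 3 (by decide)), mul_assoc,
    h _ 2 3 0 1 (hB 2 0 (by decide)) (hB 3 1 (by decide)), ← mul_assoc,
    (transp_commute hn).eq]

/-- The element `u = ⟨(1,2), (3,4)⟩` of `M(S_n)`. -/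
def uClass : SchurMultiplier (Equiv.Perm (Fin n)) :=
  schurClass (transp hn 0 1) (transp hn 2 3) (transp_commute hn)

/-- The element `⟨(1,2)(3,4), (1,3)(2,4)⟩` of `M(A_n)`. -/
def altClass : SchurMultiplier (alternatingGroup (Fin n)) :=
  schurClass (dblA hn) (dblB hn) (dbl_commute hn)

end Permutations

/-! Everything takes place in the exterior square of `G`, where `M(G)` is the kernel of the
commutator map `comm`. The relations make `comm` a crossed module: conjugation by `w` is the action
of `comm w`, so the kernel is central, and `⁅w, z⁆ = comm w ∧ comm z`. A central extension of `G`
receives a homomorphism from the exterior square taking `x ∧ y` to the commutator of lifts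
(`exists_hom_of_central`).

Nontriviality of `u` comes from the spin cover of the symmetric group in a Clifford algebra:
disjoint transpositions lift to orthogonal vectors, which anticommute. A computation valid in any
group (`wedge_mul_eq_wedge`) identifies `u` with the class of the two double transpositions in
`S_n`. Since that class comes from `A_n`, its preimage there is nontrivial as well.

For generation, let `N` be the subgroup generated by the class in the exterior square of `A_n`. If
`n ≥ 5` and `n ≠ 6, 7`, dividing by `N` gives a perfect central extension in which double
transpositions on four points have commuting lifts, and it has to be trivial
(`injective_of_commute`). Indeed each three-cycle has exactly one lift of order three conjugate to
its inverse, and these lifts multiply as the three-cycles do, closely enough to define a section.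
Uniqueness uses that the even permutations of the remaining `n - 3` points form a perfect group. The
solvable group `A_4` is treated directly as Klein group by cyclic group. The order is two because `a
∧ b` squares to `a² ∧ b = 1` for an involution `a` commuting with `b`. -/

/-- The exterior square `⟨G, G⟩ / B(G)`. -/
abbrev ExtSquare (G : Type*) [Group G] : Type _ := FreeGroup (G × G) ⧸ pairBoundaries G

/-! ### The exterior square as a crossed module over the group. -/

namespace ExtSquare

variable {G H : Type*} [Group G] [Group H]

/-- The class of `⟨x, y⟩` in the exterior square. -/
def wedge (x y : G) : ExtSquare G := QuotientGroup.mk (pairGen x y)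

/-- The commutator map from the exterior square to `G`. -/
def comm (G : Type*) [Group G] : ExtSquare G →* G :=
  QuotientGroup.lift _ (pairCommutator G) (pairBoundaries_le_pairCycles G)

@[simp] theorem comm_wedge (x y : G) : comm G (wedge x y) = ⁅x, y⁆ := by
  simp [comm, wedge, pairCommutator, pairGen]

@[simp] theorem comm_mk (w : FreeGroup (G × G)) :
    comm G (QuotientGroup.mk w) = pairCommutator G w := rfl

theorem hom_ext {M : Type*} [Monoid M] {f g : ExtSquare G →* M}
    (h : ∀ x y, f (wedge x y) = g (wedge x y)) : f = g := by
  apply QuotientGroup.monoidHom_ext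
  ext ⟨x, y⟩
  exact h x y

theorem closure_wedge :
    Subgroup.closure {w : ExtSquare G | ∃ x y, wedge x y = w} = ⊤ := by
  rw [eq_top_iff]
  rintro w -
  induction w using QuotientGroup.induction_on with
  | H w =>
    induction w using FreeGroup.induction_on with
    | C1 => exact one_mem _
    | of p => exact Subgroup.subset_closure ⟨p.1, p.2, rfl⟩
    | inv_of p h => exact inv_mem h
    | mul a b ha hb => exact mul_mem ha hb

/-- The homomorphism of exterior squares induced by a group homomorphism. -/
def map (f : G →* H) : ExtSquare G →* ExtSquare H :=
  QuotientGroup.map _ _ (pairMap f) (pairBoundaries_le_comap f)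

@[simp] theorem map_wedge (f : G →* H) (x y : G) : map f (wedge x y) = wedge (f x) (f y) := by
  simp [map, wedge]

/-- The action of `G` on its exterior square by conjugation. -/
def act (g : G) : ExtSquare G →* ExtSquare G := map (MulAut.conj g).toMonoidHom

@[simp] theorem act_wedge (g x y : G) :
    act g (wedge x y) = wedge (g * x * g⁻¹) (g * y * g⁻¹) := by
  simp [act]

theorem act_mul (g h : G) (w : ExtSquare G) : act (g * h) w = act g (act h w) := by
  have : act (g * h) = (act g).comp (act h) := hom_ext fun x y => by simp [mul_assoc]
  exact DFunLike.congr_fun this w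

theorem act_one (w : ExtSquare G) : act 1 w = w := by
  have : act (1 : G) = MonoidHom.id _ := hom_ext fun x y => by simp
  exact DFunLike.congr_fun this w

theorem eq_of_relator {r s : FreeGroup (G × G)} (h : PairRelator G (r * s⁻¹)) :
    (QuotientGroup.mk r : ExtSquare G) = QuotientGroup.mk s := by
  rw [← mul_inv_eq_one, ← QuotientGroup.mk_inv, ← QuotientGroup.mk_mul, QuotientGroup.eq_one_iff]
  exact Subgroup.subset_normalClosure h

@[simp] theorem wedge_self (x : G) : wedge x x = 1 :=
  (QuotientGroup.eq_one_iff _).2 (Subgroup.subset_normalClosure (PairRelator.diag x))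

theorem wedge_swap (x y : G) : wedge x y = (wedge y x)⁻¹ :=
  eq_of_relator (PairRelator.antisymm x y)

theorem wedge_mul_left (x y z : G) : wedge (x * y) z = act x (wedge y z) * wedge x z := by
  rw [act_wedge]
  exact eq_of_relator (PairRelator.mul_left x y z)

theorem act_wedge_eq (x y z : G) : act x (wedge y z) = wedge x ⁅y, z⁆ * wedge y z := by
  rw [act_wedge]
  exact eq_of_relator (PairRelator.conj x y z)

theorem wedge_mul_right (x y z : G) : wedge x (y * z) = wedge x y * act y (wedge x z) := by
  rw [wedge_swap, wedge_mul_left, mul_inv_rev, ← wedge_swap, ← map_inv, ← wedge_swap]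

@[simp] theorem wedge_one_left (x : G) : wedge 1 x = 1 := by
  have := wedge_mul_left 1 1 x
  rwa [act_one, mul_one, left_eq_mul] at this

@[simp] theorem wedge_one_right (x : G) : wedge x 1 = 1 := by
  rw [wedge_swap, wedge_one_left, inv_one]

theorem wedge_inv_right (x y : G) : wedge x y⁻¹ = (act y⁻¹ (wedge x y))⁻¹ := by
  rw [eq_comm, inv_eq_iff_mul_eq_one, ← inv_eq_iff_mul_eq_one, eq_comm, eq_inv_iff_mul_eq_one,
    ← wedge_mul_right, inv_mul_cancel, wedge_one_right]

/-- Expanding `xx' ∧ yy'` in two ways. -/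
theorem act_mul_wedge (a a' b b' : G) :
    act (a * b) (wedge a' b') * wedge a b = wedge a b * act (b * a) (wedge a' b') := by
  have h1 : wedge (a * a') (b * b') =
      act a (wedge a' b) * (act (a * b) (wedge a' b') * wedge a b) * act b (wedge a b') := by
    rw [wedge_mul_left, wedge_mul_right a', wedge_mul_right a, map_mul, act_mul]
    simp only [mul_assoc]
  have h2 : wedge (a * a') (b * b') =
      act a (wedge a' b) * (wedge a b * act (b * a) (wedge a' b')) * act b (wedge a b') := by
    rw [wedge_mul_right, wedge_mul_left, wedge_mul_left, map_mul, act_mul]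
    simp only [mul_assoc]
  rw [h1] at h2
  exact mul_left_cancel (mul_right_cancel h2)

/-- This is `act_mul_wedge` with the inner pair moved back by `(b * a)⁻¹`, since `a * b = ⁅a, b⁆ *
(b * a)`. -/
theorem wedge_mul_wedge_mul_inv (a b x y : G) :
    wedge a b * wedge x y * (wedge a b)⁻¹ = act ⁅a, b⁆ (wedge x y) := by
  rw [mul_inv_eq_iff_eq_mul]
  have h := act_mul_wedge a ((b * a)⁻¹ * x * (b * a)) b ((b * a)⁻¹ * y * (b * a))
  rw [act_mul b, ← act_mul, act_wedge (b * a)] at h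
  have e : a * b = ⁅a, b⁆ * (b * a) := by rw [commutatorElement_def]; group
  rw [e, act_mul, act_wedge (b * a)] at h
  simpa [mul_assoc] using h.symm

theorem mul_mul_inv_eq_act (w z : ExtSquare G) : w * z * w⁻¹ = act (comm G w) z := by
  have key (w : ExtSquare G) : ∀ z, w * z * w⁻¹ = act (comm G w) z := by
    have hw : w ∈ Subgroup.closure {w : ExtSquare G | ∃ x y, wedge x y = w} := by
      rw [closure_wedge]; trivial
    induction hw using Subgroup.closure_induction with
    | mem w h =>
      obtain ⟨a, b, rfl⟩ := h
      intro z
      have : (MulAut.conj (wedge a b)).toMonoidHom = act (comm G (wedge a b)) :=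
        hom_ext fun x y => by
          rw [comm_wedge, ← wedge_mul_wedge_mul_inv]; rfl
      exact DFunLike.congr_fun this z
    | one => intro z; simp [act_one]
    | mul w w' _ _ h h' =>
      intro z
      rw [map_mul, act_mul, ← h', ← h]
      simp only [mul_inv_rev, mul_assoc]
    | inv w _ h =>
      intro z
      have hz := h (w⁻¹ * z * w)
      rw [show w * (w⁻¹ * z * w) * w⁻¹ = z by group] at hz
      rw [map_inv, hz, ← act_mul, inv_mul_cancel, act_one, ← hz, inv_inv]
  exact key w z

theorem ker_comm_le_center : (comm G).ker ≤ Subgroup.center (ExtSquare G) := by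
  intro w hw
  rw [Subgroup.mem_center_iff]
  intro z
  have := mul_mul_inv_eq_act w z
  rw [MonoidHom.mem_ker.1 hw, act_one, mul_inv_eq_iff_eq_mul] at this
  exact this.symm

/-- The fourth defining relation is the case of a generator; it propagates to products because
conjugation by `w` is the action of `comm G w`. -/
theorem act_eq_wedge_mul (g : G) (w : ExtSquare G) : act g w = wedge g (comm G w) * w := by
  have hw : w ∈ Subgroup.closure {w : ExtSquare G | ∃ x y, wedge x y = w} := by
    rw [closure_wedge]; trivial
  induction hw using Subgroup.closure_induction with
  | mem w h =>
    obtain ⟨a, b, rfl⟩ := h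
    rw [act_wedge_eq, comm_wedge]
  | one => simp
  | mul w w' _ _ h h' =>
    rw [map_mul, map_mul, h, h', wedge_mul_right, ← mul_mul_inv_eq_act]
    group
  | inv w _ h =>
    rw [map_inv, map_inv (comm G), h, wedge_inv_right, ← map_inv (comm G), ← mul_mul_inv_eq_act]
    group

theorem act_of_comm_eq_one (g : G) {w : ExtSquare G} (h : comm G w = 1) : act g w = w := by
  rw [act_eq_wedge_mul, h, wedge_one_right, one_mul]

theorem commutator_eq_wedge (w z : ExtSquare G) : ⁅w, z⁆ = wedge (comm G w) (comm G z) := by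
  rw [commutatorElement_def, mul_mul_inv_eq_act, act_eq_wedge_mul, mul_inv_cancel_right]

theorem commute_of_comm_eq_one {w : ExtSquare G} (h : comm G w = 1) (z : ExtSquare G) :
    Commute w z :=
  ((Subgroup.mem_center_iff.1 (ker_comm_le_center (MonoidHom.mem_ker.2 h))) z).symm

theorem comm_surjective (h : commutator G = ⊤) : Function.Surjective (comm G) := by
  rw [← MonoidHom.range_eq_top, eq_top_iff, ← h, commutator_def, Subgroup.commutator_le]
  exact fun x _ y _ => ⟨wedge x y, comm_wedge x y⟩

/-- If `comm` is onto, each generator `x ∧ y` is the commutator of preimages of `x` and `y`. -/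
theorem commutator_eq_top (h : commutator G = ⊤) : commutator (ExtSquare G) = ⊤ := by
  rw [eq_top_iff, ← closure_wedge, Subgroup.closure_le]
  rintro _ ⟨x, y, rfl⟩
  obtain ⟨w, rfl⟩ := comm_surjective h x
  obtain ⟨z, rfl⟩ := comm_surjective h y
  rw [← commutator_eq_wedge]
  exact Subgroup.commutator_mem_commutator trivial trivial

/-! ### The universal property for central extensions. -/

section CentralExtension

variable {E : Type*} [Group E] {π : E →* G}

/-- Two lifts of one element differ by a central factor, which cancels in a commutator. -/
theorem commutator_eq_of_central (hc : π.ker ≤ Subgroup.center E) {a a' b b' : E}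
    (ha : π a = π a') (hb : π b = π b') : ⁅a, b⁆ = ⁅a', b'⁆ := by
  have key (x y : E) (h : π x = π y) : ∃ k, x = y * k ∧ ∀ z, k * z = z * k := by
    refine ⟨y⁻¹ * x, by simp, fun z => ?_⟩
    have : y⁻¹ * x ∈ π.ker := by simp [MonoidHom.mem_ker, h]
    exact (Subgroup.mem_center_iff.1 (hc this) z).symm
  obtain ⟨k, rfl, hk⟩ := key _ _ ha
  obtain ⟨l, rfl, hl⟩ := key _ _ hb
  simp only [commutatorElement_def, mul_inv_rev]
  calc a' * k * (b' * l) * (k⁻¹ * a'⁻¹) * (l⁻¹ * b'⁻¹)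
      = a' * (k * (b' * l)) * k⁻¹ * a'⁻¹ * (l⁻¹ * b'⁻¹) := by group
    _ = a' * b' * (l * a'⁻¹) * (l⁻¹ * b'⁻¹) := by rw [hk]; group
    _ = _ := by rw [hl]; group

/-- A central extension of `G` receives a homomorphism from the exterior square of `G`, sending
`x ∧ y` to the commutator of any lifts of `x` and `y`. -/
theorem exists_hom_of_central (hc : π.ker ≤ Subgroup.center E) (hs : Function.Surjective π) :
    ∃ f : ExtSquare G →* E, ∀ a b : E, f (wedge (π a) (π b)) = ⁅a, b⁆ := by
  have hσ := Function.surjInv_eq hs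
  set σ := Function.surjInv hs
  let F : FreeGroup (G × G) →* E := FreeGroup.lift fun p => ⁅σ p.1, σ p.2⁆
  have hF (x y : G) (a b : E) (ha : π a = x) (hb : π b = y) : F (pairGen x y) = ⁅a, b⁆ := by
    rw [pairGen, FreeGroup.lift_apply_of]
    exact commutator_eq_of_central hc (by rw [hσ, ha]) (by rw [hσ, hb])
  have hB : pairBoundaries G ≤ F.ker := by
    refine Subgroup.normalClosure_le_normal ?_
    rintro w hw
    change F w = 1
    rcases hw with x | ⟨x, y⟩ | ⟨x, y, z⟩ | ⟨x, y, z⟩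
    · rw [hF x x (σ x) (σ x) (hσ x) (hσ x), commutatorElement_self]
    · rw [map_mul, map_inv, map_inv, hF x y (σ x) (σ y) (hσ x) (hσ y),
        hF y x (σ y) (σ x) (hσ y) (hσ x)]
      simp [commutatorElement_def, mul_assoc]
    · rw [map_mul, map_inv, map_mul, hF x z (σ x) (σ z) (hσ x) (hσ z),
        hF _ _ (σ x * σ y) (σ z) (by simp [hσ]) (hσ z),
        hF _ _ (σ x * σ y * (σ x)⁻¹) (σ x * σ z * (σ x)⁻¹) (by simp [hσ]) (by simp [hσ])]
      simp [commutatorElement_def, mul_assoc]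
    · rw [map_mul, map_inv, map_mul, hF y z (σ y) (σ z) (hσ y) (hσ z),
        hF _ _ (σ x) ⁅σ y, σ z⁆ (hσ x) (by simp [hσ, map_commutatorElement]),
        hF _ _ (σ x * σ y * (σ x)⁻¹) (σ x * σ z * (σ x)⁻¹) (by simp [hσ]) (by simp [hσ])]
      simp [commutatorElement_def, mul_assoc]
  refine ⟨QuotientGroup.lift _ F hB, fun a b => ?_⟩
  exact hF _ _ a b rfl rfl

end CentralExtension

end ExtSquare

theorem schurClass_eq_iff {G : Type*} [Group G] {x y x' y' : G} (h : Commute x y)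
    (h' : Commute x' y') :
    schurClass x y h = schurClass x' y' h' ↔ ExtSquare.wedge x y = ExtSquare.wedge x' y' := by
  rw [schurClass, schurClass, QuotientGroup.eq, ExtSquare.wedge, ExtSquare.wedge, QuotientGroup.eq,
    Subgroup.mem_subgroupOf]
  rfl

theorem schurClass_eq_one_iff {G : Type*} [Group G] {x y : G} (h : Commute x y) :
    schurClass x y h = 1 ↔ ExtSquare.wedge x y = 1 := by
  rw [schurClass, QuotientGroup.eq_one_iff, ExtSquare.wedge, QuotientGroup.eq_one_iff,
    Subgroup.mem_subgroupOf]

/-! ### The spin cover of the symmetric group and nontriviality of `u`. -/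

section SpinCover

variable (α : Type*) [Fintype α] [DecidableEq α]

/-- The standard quadratic form `∑ xᵢ²`. -/
abbrev sumSquares : QuadraticForm ℚ (α → ℚ) := QuadraticMap.weightedSumSquares ℚ fun _ : α => (1 : ℚ)

/-- The pairs of a permutation `σ` and a unit `g` of the Clifford algebra for which conjugation by
`g` permutes the vectors by `sign σ • σ`. -/
def spinCover : Subgroup (Equiv.Perm α × (CliffordAlgebra (sumSquares α))ˣ) where
  carrier := {p | ∀ v : α → ℚ, (p.2 : CliffordAlgebra (sumSquares α)) * CliffordAlgebra.ι (sumSquares α) v =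
    ((Equiv.Perm.sign p.1 : ℤˣ) : ℤ) • (CliffordAlgebra.ι (sumSquares α) (v ∘ (p.1⁻¹ : Equiv.Perm α)) * p.2)}
  one_mem' v := by simp
  mul_mem' {p q} hp hq v := by
    change ∀ v, _ = _ at hp hq
    simp only [Prod.snd_mul, Units.val_mul, Prod.fst_mul, map_mul]
    rw [mul_assoc, hq, mul_smul_comm, ← mul_assoc, hp, smul_mul_assoc, smul_smul, mul_assoc,
      mul_comm]
    rfl
  inv_mem' {p} hp v := by
    change ∀ v, _ = _ at hp
    have h := hp (v ∘ p.1)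
    have e : (v ∘ p.1) ∘ (p.1⁻¹ : Equiv.Perm α) = v := by ext; simp
    rw [e] at h
    simp only [Prod.snd_inv, Prod.fst_inv, inv_inv, map_inv, Int.units_inv_eq_self]
    rw [Units.inv_mul_eq_iff_eq_mul, mul_smul_comm, ← mul_assoc, h, smul_mul_assoc, smul_smul,
      mul_assoc, Units.mul_inv, mul_one, ← Units.val_mul, Int.units_mul_self, Units.val_one,
      one_smul]

variable {α}

/-- The difference `eᵢ - eⱼ` of two basis vectors. -/
def rootVec (i j : α) : α → ℚ := Pi.single i 1 - Pi.single j 1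

theorem sumSquares_rootVec {i j : α} (h : i ≠ j) : sumSquares α (rootVec i j) = 2 := by
  have : ∀ x : α, (rootVec i j x) * (rootVec i j x) =
      (if x = i then (1 : ℚ) else 0) + (if x = j then 1 else 0) := by
    intro x
    by_cases hi : x = i
    · subst hi; simp [rootVec, h]
    · by_cases hj : x = j
      · subst hj; simp [rootVec, hi]
      · simp [rootVec, hi, hj]
  rw [QuadraticMap.weightedSumSquares_apply]
  simp only [this, smul_eq_mul, one_mul, Finset.sum_add_distrib]
  simp
  norm_num

theorem polar_rootVec (i j : α) (v : α → ℚ) :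
    QuadraticMap.polar (sumSquares α) (rootVec i j) v = 2 * (v i - v j) := by
  simp only [QuadraticMap.polar, QuadraticMap.weightedSumSquares_apply, ← Finset.sum_sub_distrib]
  have : ∀ x : α, (1 : ℚ) • ((rootVec i j + v) x * (rootVec i j + v) x) -
      (1 : ℚ) • (rootVec i j x * rootVec i j x) - (1 : ℚ) • (v x * v x) =
      2 * ((if x = i then v x else 0) - (if x = j then v x else 0)) := by
    intro x
    simp only [rootVec, Pi.add_apply, Pi.sub_apply, Pi.single_apply, smul_eq_mul]
    split_ifs <;> ring
  simp only [this, ← Finset.mul_sum, Finset.sum_sub_distrib]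
  simp

omit [Fintype α] in
theorem comp_swap_eq (i j : α) (v : α → ℚ) :
    v ∘ (Equiv.swap i j : Equiv.Perm α) = v - (v i - v j) • rootVec i j := by
  ext x
  simp only [rootVec, Function.comp_apply, Pi.sub_apply, Pi.smul_apply, Pi.single_apply,
    smul_eq_mul, Equiv.swap_apply_def]
  split_ifs <;> simp_all

theorem ι_rootVec_mul_self {i j : α} (h : i ≠ j) :
    CliffordAlgebra.ι (sumSquares α) (rootVec i j) * CliffordAlgebra.ι _ (rootVec i j) =
      algebraMap ℚ _ 2 := by
  rw [CliffordAlgebra.ι_sq_scalar, sumSquares_rootVec h]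

/-- The unit of the Clifford algebra given by `eᵢ - eⱼ`. -/
def rootUnit {i j : α} (h : i ≠ j) : (CliffordAlgebra (sumSquares α))ˣ where
  val := CliffordAlgebra.ι _ (rootVec i j)
  inv := (1 / 2 : ℚ) • CliffordAlgebra.ι _ (rootVec i j)
  val_inv := by
    rw [mul_smul_comm, ι_rootVec_mul_self h, Algebra.smul_def, ← map_mul]; norm_num
  inv_val := by
    rw [smul_mul_assoc, ι_rootVec_mul_self h, Algebra.smul_def, ← map_mul]; norm_num

/-- Conjugation by a vector of the Clifford algebra is minus the reflection in it, and the
reflection in `eᵢ - eⱼ` is the transposition; the minus sign is the sign of the transposition. -/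
theorem swap_rootUnit_mem {i j : α} (h : i ≠ j) :
    (Equiv.swap i j, rootUnit h) ∈ spinCover α := by
  intro v
  simp only [Equiv.Perm.sign_swap h, Equiv.swap_inv, comp_swap_eq, rootUnit]
  have := CliffordAlgebra.ι_mul_ι_add_swap (Q := sumSquares α) (rootVec i j) v
  rw [polar_rootVec] at this
  rw [map_sub, map_smul, sub_mul, smul_mul_assoc, ι_rootVec_mul_self h, 
    Algebra.smul_def (v i - v j), ← map_mul (algebraMap ℚ _), mul_comm (v i - v j), ← this]
  simp

/-- The projection of the spin cover to the permutation group. -/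
def spinProj (α : Type*) [Fintype α] [DecidableEq α] : spinCover α →* Equiv.Perm α :=
  (MonoidHom.fst _ _).comp (spinCover α).subtype

theorem spinProj_surjective : Function.Surjective (spinProj α) := by
  rw [← MonoidHom.range_eq_top, eq_top_iff, ← Equiv.Perm.closure_isSwap, Subgroup.closure_le]
  rintro _ ⟨i, j, h, rfl⟩
  exact ⟨⟨_, swap_rootUnit_mem h⟩, rfl⟩

/-- A unit lying over the identity commutes with all vectors, and these generate the Clifford
algebra. -/
theorem ker_spinProj_le_center : (spinProj α).ker ≤ Subgroup.center (spinCover α) := by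
  rintro ⟨⟨σ, g⟩, hg⟩ h1
  obtain rfl : σ = 1 := h1
  have hv (v : α → ℚ) : (g : CliffordAlgebra (sumSquares α)) * CliffordAlgebra.ι (sumSquares α) v =
      CliffordAlgebra.ι (sumSquares α) v * g := by simpa using hg v
  have hx (x : CliffordAlgebra (sumSquares α)) : (g : CliffordAlgebra (sumSquares α)) * x =
      x * g := by
    induction x using CliffordAlgebra.induction with
    | algebraMap r => exact (Algebra.commutes r _).symm
    | ι v => exact hv v
    | mul a b ha hb => rw [← mul_assoc, ha, mul_assoc, hb, mul_assoc]
    | add a b ha hb => rw [mul_add, add_mul, ha, hb]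
  rw [Subgroup.mem_center_iff]
  rintro ⟨⟨τ, k⟩, hk⟩
  refine Subtype.ext (Prod.ext (by simp) (Units.ext ?_))
  exact (hx k).symm

/-- The two vectors are orthogonal, so they anticommute. If they also commuted, twice their product
would vanish, although the product is a unit. -/
theorem rootUnit_commutator_ne_one {i j k l : α} (hij : i ≠ j) (hkl : k ≠ l) (hik : i ≠ k)
    (hil : i ≠ l) (hjk : j ≠ k) (hjl : j ≠ l) : ⁅rootUnit hij, rootUnit hkl⁆ ≠ 1 := by
  intro h
  rw [commutatorElement_eq_one_iff_mul_comm] at h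
  have hp := CliffordAlgebra.ι_mul_ι_add_swap (Q := sumSquares α) (rootVec i j) (rootVec k l)
  rw [polar_rootVec] at hp
  have h0 : (2 : ℚ) * (rootVec k l i - rootVec k l j) = 0 := by
    simp [rootVec, hik, hil, hjk, hjl]
  have h' : CliffordAlgebra.ι (sumSquares α) (rootVec k l) * CliffordAlgebra.ι _ (rootVec i j) =
    CliffordAlgebra.ι _ (rootVec i j) * CliffordAlgebra.ι _ (rootVec k l) := (Units.ext_iff.1 h).symm
  rw [h0, map_zero, h', ← two_smul ℚ, smul_eq_zero] at hp
  rcases hp with hp | hp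
  · norm_num at hp
  · exact (rootUnit hij * rootUnit hkl).ne_zero hp

theorem wedge_swap_swap_ne_one {i j k l : α} (hij : i ≠ j) (hkl : k ≠ l) (hik : i ≠ k)
    (hil : i ≠ l) (hjk : j ≠ k) (hjl : j ≠ l) :
    ExtSquare.wedge (Equiv.swap i j) (Equiv.swap k l) ≠ 1 := by
  intro h
  obtain ⟨f, hf⟩ := ExtSquare.exists_hom_of_central ker_spinProj_le_center
    (spinProj_surjective (α := α))
  have := hf ⟨_, swap_rootUnit_mem hij⟩ ⟨_, swap_rootUnit_mem hkl⟩
  rw [show spinProj α ⟨_, swap_rootUnit_mem hij⟩ = Equiv.swap i j from rfl,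
    show spinProj α ⟨_, swap_rootUnit_mem hkl⟩ = Equiv.swap k l from rfl, h, map_one] at this
  exact rootUnit_commutator_ne_one hij hkl hik hil hjk hjl
    (congrArg (fun x : spinCover α => x.1.2) this).symm

end SpinCover

theorem uClass_ne_one {n : ℕ} (hn : 4 ≤ n) : uClass hn ≠ 1 := by
  rw [uClass, Ne, schurClass_eq_one_iff]
  apply wedge_swap_swap_ne_one <;> simp

/-! ### Identities for involutions, and the comparison of the two classes. -/

namespace ExtSquare

variable {G : Type*} [Group G]

/-- Expand `a² ∧ b`: the action of `a` fixes `a ∧ b`, whose commutator is trivial. -/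
theorem wedge_sq_eq_one {a b : G} (ha : a * a = 1) (h : Commute a b) :
    wedge a b * wedge a b = 1 := by
  have h1 := wedge_mul_left a a b
  rw [act_of_comm_eq_one a (by rw [comm_wedge, commutatorElement_eq_one_iff_commute.2 h]), ha,
    wedge_one_left] at h1
  exact h1.symm

/-- Put `v = ab ∧ c`, a central element. Expanding `v` gives `(a ∧ b)(b ∧ c)(a ∧ c)`. Acting by `c`
on `a ∧ c` gives `b ∧ c`, and also `v⁻¹(a ∧ c)` by the fourth relation. As `a ∧ c² = 1`, the last
two factors cancel. For `a = (1,2)`, `b = (3,4)`, `c = (1,3)(2,4)` this compares the two classes. -/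
theorem wedge_mul_eq_wedge {a b c : G} (ha : a * a = 1) (hb : b * b = 1) (hc : c * c = 1)
    (hab : Commute a b) (hcab : c * a * c⁻¹ = b) : wedge (a * b) c = wedge a b := by
  have hcc : c⁻¹ = c := inv_eq_of_mul_eq_one_left hc
  have hcba : c * b * c⁻¹ = a := by
    rw [← hcab, hcc]
    calc c * (c * a * c) * c = (c * c) * a * (c * c) := by group
      _ = a := by rw [hc]; simp
  have hac : ⁅a, c⁆ = a * b := by
    rw [commutatorElement_def, ← inv_eq_of_mul_eq_one_left hb, ← hcab]; group
  have hbc : ⁅b, c⁆ = b * a := by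
    rw [commutatorElement_def, ← inv_eq_of_mul_eq_one_left ha, ← hcba]; group
  have hv : comm G (wedge (a * b) c) = 1 := by
    have h : c * (a * b) * c⁻¹ = a * b := by
      rw [show c * (a * b) * c⁻¹ = c * a * c⁻¹ * (c * b * c⁻¹) by group, hcab, hcba, hab.eq]
    rw [comm_wedge, commutatorElement_eq_one_iff_mul_comm]
    exact (mul_inv_eq_iff_eq_mul.1 h).symm
  have h1 : wedge a c * act c (wedge a c) = 1 := by
    rw [← wedge_mul_right, hc, wedge_one_right]
  have h2 : act c (wedge a c) = wedge b c := by
    rw [act_wedge, hcab, mul_inv_cancel_right]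
  have h3 : act c (wedge a c) = (wedge (a * b) c)⁻¹ * wedge a c := by
    rw [act_wedge_eq, hac, wedge_swap]
  have h4 : wedge (a * b) c = wedge a b * wedge b c * wedge a c := by
    rw [wedge_mul_left, act_wedge_eq, hbc, wedge_mul_right, wedge_self, map_one, mul_one]
  rw [← h2, h3] at h4
  rw [h3, ← mul_assoc, ((commute_of_comm_eq_one hv _).inv_left.eq).symm] at h1
  rw [mul_assoc, h1, mul_one] at h4
  exact h4

end ExtSquare

section Transpositions

variable {n : ℕ} (hn : 4 ≤ n)

theorem transp_mul_self (i j : Fin 4) : transp hn i j * transp hn i j = 1 :=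
  Equiv.swap_mul_self _ _

theorem wedge_dbl :
    ExtSquare.wedge (dblA hn : Equiv.Perm (Fin n)) (dblB hn : Equiv.Perm (Fin n)) =
      ExtSquare.wedge (transp hn 0 1) (transp hn 2 3) := by
  have hd : Commute (transp hn 0 2) (transp hn 1 3) :=
    (Equiv.Perm.disjoint_swap_swap (by simp)).commute
  refine ExtSquare.wedge_mul_eq_wedge (transp_mul_self hn _ _) (transp_mul_self hn _ _) ?_
    (transp_commute hn) ?_
  · change transp hn 0 2 * transp hn 1 3 * (transp hn 0 2 * transp hn 1 3) = 1
    rw [hd.symm.mul_mul_mul_comm, transp_mul_self, transp_mul_self, one_mul]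
  · change transp hn 0 2 * transp hn 1 3 * transp hn 0 1 * (transp hn 0 2 * transp hn 1 3)⁻¹ = _
    simp only [transp]
    rw [← Equiv.swap_apply_apply]
    congr 1

theorem dblA_mul_self : dblA hn * dblA hn = 1 := by
  apply Subtype.ext
  change transp hn 0 1 * transp hn 2 3 * (transp hn 0 1 * transp hn 2 3) = 1
  rw [(transp_commute hn).symm.mul_mul_mul_comm, transp_mul_self, transp_mul_self, one_mul]

end Transpositions

/-! ### Sections built from lifts of three-cycles. -/

section ThreeCycleLifts

open Equiv.Perm

variable {α : Type*} [Fintype α] [DecidableEq α]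

theorem Equiv.Perm.IsThreeCycle.apply_apply_apply {g : Equiv.Perm α} (h : g.IsThreeCycle) (x : α) :
    g (g (g x)) = x := by
  have : g ^ 3 = 1 := by rw [← h.orderOf, pow_orderOf_eq_one]
  simpa [pow_succ] using DFunLike.congr_fun this x

theorem Equiv.Perm.IsThreeCycle.eq_or_eq_or_eq {g : Equiv.Perm α} (h : g.IsThreeCycle) {x y : α}
    (hx : g x ≠ x) (hy : g y ≠ y) : y = x ∨ y = g x ∨ y = g (g x) := by
  have := h.support_eq_iff_mem_support.2 (mem_support.2 hx)
  have hy' := mem_support.2 hy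
  rw [this] at hy'
  simpa using hy'

theorem isThreeCycle_swap_mul_swap {x y z : α} (hxy : x ≠ y) (hxz : x ≠ z) (hyz : y ≠ z) :
    (Equiv.swap x y * Equiv.swap y z).IsThreeCycle := by
  rw [Equiv.swap_comm x y]
  exact isThreeCycle_swap_mul_swap_same hxy.symm hyz hxz

/-- A family of lifts of three-cycles that is closed under inverses, conjugation and those products
that are again three-cycles on four points is a section over the subgroup it generates. -/
theorem eq_one_of_mem_closure_of_map_eq_one {E : Type*} [Group E] (π : E →* Equiv.Perm α)
    (T : Set E) (hinv : ∀ e ∈ T, e⁻¹ ∈ T) (hconj : ∀ e ∈ T, ∀ f ∈ T, e * f * e⁻¹ ∈ T)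
    (h3 : ∀ e ∈ T, (π e).IsThreeCycle) (hcube : ∀ e ∈ T, e * e * e = 1)
    (hex : ∀ σ : Equiv.Perm α, σ.IsThreeCycle → ∃ e ∈ T, π e = σ)
    (hmul : ∀ e ∈ T, ∀ f ∈ T, ∀ x, π f x ≠ x → π e (π f x) = x → e * f = 1 ∨ e * f ∈ T)
    {h : E} (hh : h ∈ Subgroup.closure T) (h1 : π h = 1) : h = 1 := by
  -- Induction on the set of points that may move. When `p` is added, every element of the larger
  -- subgroup lies in the smaller one or in a coset `e * closure TS` with `e` a lift moving `p`. An
  -- element over the identity fixes `p`, which rules out the second kind.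
  suffices key : ∀ (S : Finset α) (h : E),
      h ∈ Subgroup.closure {e | e ∈ T ∧ ∀ q, q ∉ S → π e q = q} → π h = 1 → h = 1 by
    refine key Finset.univ h ?_ h1
    convert hh using 2
    ext; simp
  clear hh h1 h
  intro S
  induction S using Finset.induction with
  | empty =>
    intro h hh _
    have : {e | e ∈ T ∧ ∀ q, q ∉ (∅ : Finset α) → π e q = q} = ∅ := by
      rw [Set.eq_empty_iff_forall_notMem]
      rintro e ⟨he, hq⟩
      exact (h3 e he).ne_one (Equiv.ext fun q => hq q (by simp))
    rw [this, Subgroup.closure_empty] at hh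
    exact hh
  | insert p S hp ih =>
    set TS : Set E := {e | e ∈ T ∧ ∀ q, q ∉ S → π e q = q} with hTS
    set TP : Set E := {e | e ∈ T ∧ ∀ q, q ∉ insert p S → π e q = q} with hTP
    have mul_fix {e f : E} (he : ∀ q, q ∉ insert p S → π e q = q)
        (hf : ∀ q, q ∉ insert p S → π f q = q) : ∀ q, q ∉ insert p S → π (e * f) q = q := by
      intro q hq
      rw [map_mul, Equiv.Perm.mul_apply, hf q hq, he q hq]
    have inv_fix {e : E} (he : ∀ q, q ∉ insert p S → π e q = q) :
        ∀ q, q ∉ insert p S → π e⁻¹ q = q := by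
      intro q hq
      rw [map_inv, Equiv.Perm.inv_eq_iff_eq, he q hq]
    have TPinv {e : E} (he : e ∈ TP) : e⁻¹ ∈ TP := ⟨hinv e he.1, inv_fix he.2⟩
    have drop {e : E} (he : e ∈ TP) (hep : π e p = p) : e ∈ TS := by
      refine ⟨he.1, fun q hq => ?_⟩
      by_cases hqp : q = p
      · rw [hqp, hep]
      · exact he.2 q (by simp [hq, hqp])
    have mem {e : E} (he : e ∈ TP) {x : α} (hx : π e x ≠ x) : x ∈ insert p S := by
      by_contra hx'
      exact hx (he.2 x hx')
    have mul_mem_closure {e f : E} (he : e ∈ TP) (hf : f ∈ TP) (hfp : π f p ≠ p)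
        (hef : π e (π f p) = p) : e * f ∈ Subgroup.closure TS := by
      rcases hmul e he.1 f hf.1 p hfp hef with h | h
      · rw [h]; exact one_mem _
      · refine Subgroup.subset_closure (drop ⟨h, mul_fix he.2 hf.2⟩ ?_)
        rw [map_mul, Equiv.Perm.mul_apply, hef]
    have fix_of_mem {h : E} (hh : h ∈ Subgroup.closure TS) : π h p = p := by
      induction hh using Subgroup.closure_induction with
      | mem e he => exact he.2 p hp
      | one => simp
      | mul a b _ _ ha hb => rw [map_mul, Equiv.Perm.mul_apply, hb, ha]
      | inv a _ ha => rw [map_inv, Equiv.Perm.inv_eq_iff_eq, ha]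
    -- Left multiplication by a lift `c` preserves the two kinds. When both `c` and `e` move `p`,
    -- the cases depend on where `π c` sends `π e p`: to `p`, to itself, or elsewhere.
    have step (c : E) (hc : c ∈ TP) (h : E)
        (hh : h ∈ Subgroup.closure TS ∨ ∃ e ∈ TP, π e p ≠ p ∧ e⁻¹ * h ∈ Subgroup.closure TS) :
        c * h ∈ Subgroup.closure TS ∨
          ∃ e ∈ TP, π e p ≠ p ∧ e⁻¹ * (c * h) ∈ Subgroup.closure TS := by
      by_cases hcp : π c p = p
      · rcases hh with hh | ⟨e, he, hep, hh⟩
        · exact Or.inl (mul_mem (Subgroup.subset_closure (drop hc hcp)) hh)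
        · refine Or.inr ⟨c * e * c⁻¹, ⟨hconj c hc.1 e he.1, ?_⟩, ?_, ?_⟩
          · exact mul_fix (mul_fix hc.2 he.2) (inv_fix hc.2)
          · have hcp' : (π c)⁻¹ p = p := by rw [Equiv.Perm.inv_eq_iff_eq, hcp]
            intro h'
            rw [map_mul, map_mul, map_inv, Equiv.Perm.mul_apply, Equiv.Perm.mul_apply, hcp'] at h'
            exact hep ((π c).injective (h'.trans hcp.symm))
          · rw [show (c * e * c⁻¹)⁻¹ * (c * h) = c * (e⁻¹ * h) by group]
            exact mul_mem (Subgroup.subset_closure (drop hc hcp)) hh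
      rcases hh with hh | ⟨e, he, hep, hh⟩
      · exact Or.inr ⟨c, hc, hcp, by simpa using hh⟩
      by_cases h1 : π c (π e p) = p
      · left
        rw [show c * h = c * e * (e⁻¹ * h) by group]
        exact mul_mem (mul_mem_closure hc he hep h1) hh
      by_cases h2 : π c (π e p) = π e p
      · have hcpe : π c p ≠ π e p := fun h => hep ((π c).injective (h2.trans h.symm))
        -- The lift `f` of the cycle `p ↦ π e p ↦ π c p ↦ p` mediates: `c * f` is again in `T` and
        -- sends `p` to `π e p`, while `f⁻¹ * e` fixes `p`.
        obtain ⟨f, hf, hfe⟩ := hex _ (isThreeCycle_swap_mul_swap (Ne.symm hep) (Ne.symm hcp) hcpe.symm)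
        have hfp : π f p = π e p := by
          rw [hfe, Equiv.Perm.mul_apply, Equiv.swap_apply_of_ne_of_ne (Ne.symm hep) (Ne.symm hcp),
            Equiv.swap_apply_left]
        have hfc : π f (π c p) = p := by
          rw [hfe, Equiv.Perm.mul_apply, Equiv.swap_apply_right, Equiv.swap_apply_right]
        have hfTP : f ∈ TP := by
          refine ⟨hf, fun q hq => ?_⟩
          have q1 : q ≠ p := fun h => hq (by simp [h])
          have q2 : q ≠ π e p := fun h => hq (h ▸ mem he (fun h' => hep ((π e).injective h')))
          have q3 : q ≠ π c p := fun h => hq (h ▸ mem hc (fun h' => hcp ((π c).injective h')))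
          rw [hfe, Equiv.Perm.mul_apply, Equiv.swap_apply_of_ne_of_ne q2 q3,
            Equiv.swap_apply_of_ne_of_ne q1 q2]
        have hcf : π (c * f) p = π e p := by rw [map_mul, Equiv.Perm.mul_apply, hfp, h2]
        have hcfT : c * f ∈ T := by
          refine (hmul c hc.1 f hf (π c p) ?_ ?_).resolve_left fun h => ?_
          · rw [hfc]; exact Ne.symm hcp
          · rw [hfc]
          · rw [h, map_one] at hcf
            exact hep hcf.symm
        refine Or.inr ⟨c * f, ⟨hcfT, mul_fix hc.2 hfTP.2⟩, by rwa [hcf], ?_⟩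
        rw [show (c * f)⁻¹ * (c * h) = f⁻¹ * e * (e⁻¹ * h) by group]
        refine mul_mem (mul_mem_closure (TPinv hfTP) he hep ?_) hh
        rw [map_inv, Equiv.Perm.inv_eq_iff_eq, hfp]
      -- Now `π c` moves `p` and `π e p` without sending the latter to `p`, which leaves one
      -- position in its cycle. The new coset representative is `c * c = c⁻¹`.
      have h4 : π c p = π e p := by
        rcases (h3 c hc.1).eq_or_eq_or_eq hcp h2 with h | h | h
        · exact absurd h hep
        · exact h.symm
        · rw [h, (h3 c hc.1).apply_apply_apply] at h1
          exact absurd rfl h1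
      have hcc : c * c = c⁻¹ := eq_inv_of_mul_eq_one_left (hcube c hc.1)
      refine Or.inr ⟨c⁻¹, TPinv hc, ?_, ?_⟩
      · rw [← hcc, map_mul, Equiv.Perm.mul_apply, h4]; exact h1
      · rw [inv_inv, ← mul_assoc, hcc, show c⁻¹ * h = c⁻¹ * e * (e⁻¹ * h) by group]
        refine mul_mem (mul_mem_closure (TPinv hc) he hep ?_) hh
        rw [map_inv, Equiv.Perm.inv_eq_iff_eq, h4]
    intro h hh h1
    have hcase : h ∈ Subgroup.closure TS ∨
        ∃ e ∈ TP, π e p ≠ p ∧ e⁻¹ * h ∈ Subgroup.closure TS := by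
      clear h1
      induction hh using Subgroup.closure_induction_left with
      | one => exact Or.inl (one_mem _)
      | mul_left c hc h _ ih' => exact step c hc h ih'
      | inv_mul_cancel c hc h _ ih' => exact step _ (TPinv hc) h ih'
    rcases hcase with hh | ⟨e, he, hep, hh⟩
    · exact ih h hh h1
    · have := fix_of_mem hh
      rw [map_mul, h1, mul_one, map_inv, Equiv.Perm.inv_eq_iff_eq] at this
      exact absurd this.symm hep

end ThreeCycleLifts

/-! ### Canonical lifts of elements of order three to central extensions. -/

section CentralLifts

variable {G E : Type*} [Group G] [Group E] {π : E →* G}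

theorem mul_comm_of_map_eq_one (hc : π.ker ≤ Subgroup.center E) {k : E} (h : π k = 1) (z : E) :
    Commute k z :=
  ((Subgroup.mem_center_iff.1 (hc (MonoidHom.mem_ker.2 h))) z).symm

/-- Commuting with the elements of a perfect group lifts to central extensions. -/
theorem commute_of_perfect (hc : π.ker ≤ Subgroup.center E) (hs : Function.Surjective π)
    {P : Type*} [Group P] (hP : commutator P = ⊤) (f : P →* G) {y : E}
    (hf : ∀ t, Commute (f t) (π y)) (t : P) {x : E} (hx : π x = f t) : Commute x y := by
  have ht : t ∈ Subgroup.closure (commutatorSet P) := by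
    rw [← commutator_eq_closure, hP]; trivial
  induction ht using Subgroup.closure_induction generalizing x with
  | mem t ht =>
    obtain ⟨a, b, rfl⟩ := ht
    obtain ⟨x₁, h₁⟩ := hs (f a)
    obtain ⟨x₂, h₂⟩ := hs (f b)
    have hy (t : P) (z : E) (hz : π z = f t) : π (y * z * y⁻¹) = π z := by
      rw [map_mul, map_mul, map_inv, hz, ← (hf t).eq, mul_inv_cancel_right]
    -- Conjugation by `y` keeps each lift in its fibre, and the commutator depends only on the
    -- fibres.
    have hcom : Commute y ⁅x₁, x₂⁆ := by
      rw [Commute, SemiconjBy, ← mul_inv_eq_iff_eq_mul]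
      have h := map_commutatorElement (MulAut.conj y) x₁ x₂
      simp only [MulAut.conj_apply] at h
      rw [h]
      exact ExtSquare.commutator_eq_of_central hc (hy a x₁ h₁) (hy b x₂ h₂)
    have hk : π (x * ⁅x₁, x₂⁆⁻¹) = 1 := by
      rw [map_mul, map_inv, hx, map_commutatorElement, map_commutatorElement, h₁, h₂,
        mul_inv_cancel]
    have := (mul_comm_of_map_eq_one hc hk y).mul_left hcom.symm
    rwa [inv_mul_cancel_right] at this
  | one => exact mul_comm_of_map_eq_one hc (by rw [hx, map_one]) y
  | mul a b _ _ ha hb =>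
    obtain ⟨x₁, h₁⟩ := hs (f a)
    have := (ha h₁).mul_left (hb (x := x₁⁻¹ * x) (by rw [map_mul, map_inv, h₁, hx, map_mul]; simp))
    rwa [mul_inv_cancel_left] at this
  | inv a _ ha =>
    have := (ha (x := x⁻¹) (by rw [map_inv, hx, map_inv, inv_inv])).inv_left
    rwa [inv_inv] at this

/-- The lifts of order three that are conjugate to their inverses. -/
def RealCubeLift (e : E) : Prop := e ^ 3 = 1 ∧ ∃ g, g * e * g⁻¹ = e⁻¹

theorem RealCubeLift.inv {e : E} (h : RealCubeLift e) : RealCubeLift e⁻¹ := by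
  obtain ⟨h1, g, hg⟩ := h
  refine ⟨by rw [inv_pow, h1, inv_one], g, ?_⟩
  rw [← conj_inv, hg]

theorem RealCubeLift.conj {e : E} (h : RealCubeLift e) (c : E) : RealCubeLift (c * e * c⁻¹) := by
  obtain ⟨h1, g, hg⟩ := h
  refine ⟨by rw [conj_pow, h1]; simp, c * g * c⁻¹, ?_⟩
  rw [show c * g * c⁻¹ * (c * e * c⁻¹) * (c * g * c⁻¹)⁻¹ = c * (g * e * g⁻¹) * c⁻¹ by group, hg]
  group

/-- The two lifts differ by a central `z`. Comparing cubes gives `z³ = 1`. By `hcomm` both inverting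
elements act alike on `e`, so comparing inverses gives `z² = 1`. -/
theorem RealCubeLift.eq_of_map_eq (hc : π.ker ≤ Subgroup.center E) {e e' : E}
    (h : RealCubeLift e) (h' : RealCubeLift e') (hee : π e = π e')
    (hcomm : ∀ x, Commute (π x) (π e) → Commute x e) : e = e' := by
  obtain ⟨h1, g, hg⟩ := h
  obtain ⟨h1', g', hg'⟩ := h'
  obtain ⟨z, rfl⟩ : ∃ z, e' = e * z := ⟨e⁻¹ * e', by group⟩
  have hz1 : π z = 1 := by simpa using hee
  have hz := mul_comm_of_map_eq_one hc hz1
  have hz3 : z ^ 3 = 1 := by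
    rwa [(hz e).symm.mul_pow, h1, one_mul] at h1'
  have hx : Commute (g⁻¹ * g') e := by
    apply hcomm
    have e1 := congrArg π hg
    have e2 := congrArg π hg'
    simp only [map_mul, map_inv, hz1, mul_one] at e1 e2
    rw [Commute, SemiconjBy, map_mul, map_inv]
    rw [← e1, mul_inv_eq_iff_eq_mul] at e2
    rw [mul_assoc, e2]
    group
  have hg'' : g' * e * g'⁻¹ = e⁻¹ := by
    rw [← hg, mul_inv_eq_iff_eq_mul]
    have := hx.eq
    rw [mul_assoc, inv_mul_eq_iff_eq_mul] at this
    rw [this]; group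
  have hz2 : z * z = 1 := by
    rw [← mul_assoc, mul_assoc (g' * e), (hz _).eq, ← mul_assoc, hg'', mul_inv_rev, (hz _).inv_left.eq,
      mul_right_inj] at hg'
    rw [← eq_inv_iff_mul_eq_one]; exact hg'
  have : z = 1 := by
    rw [pow_succ, pow_two, hz2, one_mul] at hz3
    exact hz3
  rw [this, mul_one]

/-- For any lift `y` with `g y g⁻¹ = y⁻¹ k`, the elements `k` and `m = y³` are central and cubing
gives `m² = k³`. Hence `t = m k⁻¹` satisfies `t² = k` and `t³ = m`, and `y t⁻¹` corrects both
defects at once. -/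
theorem exists_realCubeLift (hc : π.ker ≤ Subgroup.center E) (hs : Function.Surjective π) {σ γ : G}
    (h3 : σ ^ 3 = 1) (hγ : γ * σ * γ⁻¹ = σ⁻¹) : ∃ e, RealCubeLift e ∧ π e = σ := by
  obtain ⟨y, rfl⟩ := hs σ
  obtain ⟨g, rfl⟩ := hs γ
  obtain ⟨k, hk⟩ : ∃ k, g * y * g⁻¹ = y⁻¹ * k := ⟨y * (g * y * g⁻¹), by group⟩
  have hk1 : π k = 1 := by
    have := congrArg π hk
    simp only [map_mul, map_inv, hγ] at this
    simpa using this
  have hkc := mul_comm_of_map_eq_one hc hk1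
  have hm1 : π (y ^ 3) = 1 := by rw [map_pow, h3]
  have hmc := mul_comm_of_map_eq_one hc hm1
  have hmk : y ^ 3 * y ^ 3 = k ^ 3 := by
    have h := congrArg (· ^ 3) hk
    simp only [conj_pow, (hkc _).symm.mul_pow] at h
    rw [← (hmc g).eq, mul_inv_cancel_right, inv_pow] at h
    exact eq_inv_mul_iff_mul_eq.1 h
  set m := y ^ 3
  have ht1 : π (m * k⁻¹) = 1 := by rw [map_mul, map_inv, hm1, hk1]; simp
  have htc := mul_comm_of_map_eq_one hc ht1
  have ht2 : m * k⁻¹ * (m * k⁻¹) = k := by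
    rw [(hkc m).inv_left.mul_mul_mul_comm, hmk]; group
  have ht3 : (m * k⁻¹) ^ 3 = m := by
    rw [pow_succ, pow_two, ht2, ← (hkc _).symm.eq]; group
  refine ⟨y * (m * k⁻¹)⁻¹, ⟨?_, g, ?_⟩, by rw [map_mul, map_inv, ht1]; simp⟩
  · rw [((htc y).symm.inv_right).mul_pow, inv_pow, ht3, mul_inv_cancel]
  · generalize m * k⁻¹ = t at *
    rw [← mul_assoc, mul_assoc (g * y), (htc g⁻¹).inv_left.eq, ← mul_assoc, hk, ← ht2, mul_inv_rev,
      inv_inv, (htc _).eq, ← mul_assoc, mul_inv_cancel_right]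
    exact (htc _).symm.eq

/-- This puts a product of canonical lifts back among their conjugates. The two hypotheses on `A *
B` give two expressions for `B A⁻¹ B`; equating them yields `B⁻¹ = A B A`, so the relations `A³ = B³
= (AB)² = 1` of `A_4` hold in `E` itself. -/
theorem inv_mul_eq_conj_of_commute {A B : E} (hA : A ^ 3 = 1)
    (hcomm : Commute (A * B) (A * (A * B) * A⁻¹))
    (hB : A * (A * B) * A⁻¹ * A⁻¹ * (A * (A * B) * A⁻¹)⁻¹ = B) (hB3 : B ^ 3 = 1) :
    A⁻¹ * B = B * A * B⁻¹ := by
  have hA' : A * A = A⁻¹ := eq_inv_of_mul_eq_one_left (by rw [← hA, pow_succ, pow_two])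
  have hB' : B * B = B⁻¹ := eq_inv_of_mul_eq_one_left (by rw [← hB3, pow_succ, pow_two])
  have h1 : B * A⁻¹ * B = A * B⁻¹ * A := by
    have h := hcomm.eq
    have h' : A * (B * (A * A) * B * A⁻¹) = A * (A * (B * B)) := by
      calc _ = A * B * (A * (A * B) * A⁻¹) := by group
        _ = _ := by rw [h]; group
    rw [hA', hB', mul_right_inj, mul_inv_eq_iff_eq_mul] at h'
    exact h'
  have h2 : B * A⁻¹ * B = A⁻¹ * B * A⁻¹ := by
    rw [mul_inv_eq_iff_eq_mul, ← mul_assoc A A B, hA', mul_inv_eq_iff_eq_mul] at hB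
    rw [hB]
    group
  have h3 : B⁻¹ = A * B * A := by
    have h := h1.symm.trans h2
    calc B⁻¹ = A⁻¹ * (A * B⁻¹ * A) * A⁻¹ := by group
      _ = (A * A)⁻¹ * B * (A * A)⁻¹ := by rw [h]; group
      _ = _ := by rw [hA']; group
  calc A⁻¹ * B = A⁻¹ * B * A⁻¹ * A := by group
    _ = B * (A * A) * B * A := by rw [← h2, hA']
    _ = B * A * (A * B * A) := by group
    _ = _ := by rw [h3]

/-- A consequence of the relations of `A_4`, applied downstairs; uniqueness of canonical lifts then
carries it to the extension. -/
theorem conj_eq_of_mul_sq_eq_one {a b : E} (ha : a ^ 3 = 1) (hb : b ^ 3 = 1)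
    (hab : a * b * (a * b) = 1) :
    a * (a * b) * a⁻¹ * a⁻¹ * (a * (a * b) * a⁻¹)⁻¹ = b := by
  have hA' : a * a = a⁻¹ := eq_inv_of_mul_eq_one_left (by rw [← ha, pow_succ, pow_two])
  have hB' : b * b = b⁻¹ := eq_inv_of_mul_eq_one_left (by rw [← hb, pow_succ, pow_two])
  have h : b⁻¹ = a * b * a := (eq_inv_of_mul_eq_one_left (by rw [← hab]; group)).symm
  calc _ = a * a * b * a⁻¹ * b⁻¹ * a⁻¹ * a⁻¹ := by group
    _ = a * a * (b * b) * a⁻¹ := by rw [h]; group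
    _ = (a * b * a)⁻¹ := by rw [hA', hB']; group
    _ = b := by rw [← h, inv_inv]

end CentralLifts

/-! ### Perfect central extensions of alternating groups. -/

section AlternatingExtensions

open Equiv.Perm

variable {α : Type*} [Fintype α] [DecidableEq α] {E : Type*} [Group E]
  {π : E →* alternatingGroup α}

theorem commutator_alternatingGroup_eq_top_of_card (β : Type*) [Fintype β] [DecidableEq β]
    (h : Nat.card β ≤ 2 ∨ 5 ≤ Nat.card β) : commutator (alternatingGroup β) = ⊤ := by
  rcases h with h | h
  · rw [eq_top_iff]
    rintro ⟨x, hx⟩ -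
    rw [alternatingGroup.eq_bot_of_card_le_two h] at hx
    have : (⟨x, by rw [hx]; exact one_mem _⟩ : alternatingGroup β) = 1 := Subtype.ext hx
    rw [this]
    exact one_mem _
  · exact commutator_alternatingGroup_eq_top h

/-- The three-cycles and their centralizers lift to commuting elements, since the even permutations
of the other points form a perfect group. -/
theorem commute_of_isThreeCycle (hc : π.ker ≤ Subgroup.center E) (hs : Function.Surjective π)
    (hα : Nat.card α = 5 ∨ 8 ≤ Nat.card α) {x y : E}
    (hy : (π y : Equiv.Perm α).IsThreeCycle) (hxy : Commute (π x) (π y)) : Commute x y := by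
  obtain ⟨a, ha⟩ : ∃ a, (π y : Equiv.Perm α) a ≠ a := by
    by_contra! h
    exact hy.ne_one (Equiv.ext h)
  have hsupp := hy.support_eq_iff_mem_support.2 (mem_support.2 ha)
  have comm_apply {z : E} (hz : Commute (π z) (π y)) (b : α) :
      (π z : Equiv.Perm α) ((π y : Equiv.Perm α) b) = (π y : Equiv.Perm α) ((π z : Equiv.Perm α) b) :=
    DFunLike.congr_fun (congrArg Subtype.val hz.eq) b
  have key (z : E) (hz : Commute (π z) (π y)) (hza : (π z : Equiv.Perm α) a = a) :
      Commute z y := by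
    set s : Finset α := (π y : Equiv.Perm α).supportᶜ with hsdef
    have hcard : Nat.card s = Nat.card α - 3 := by
      rw [Nat.card_eq_fintype_card, Fintype.card_coe, hsdef, Finset.card_compl, hy.card_support,
        Nat.card_eq_fintype_card]
    -- The complement has two points or at least five. For `n = 6, 7` it would have three or four,
    -- and neither `A_3` nor `A_4` is perfect.
    have hP := commutator_alternatingGroup_eq_top_of_card s (by omega)
    have hmem : π z ∈ (alternatingGroup.ofSubtype s).range := by
      rw [alternatingGroup.mem_range_ofSubtype_iff]
      intro b hb
      rw [hsdef, Finset.mem_compl, hsupp]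
      rw [mem_support] at hb
      intro hb'
      simp only [Finset.mem_insert, Finset.mem_singleton] at hb'
      rcases hb' with rfl | rfl | rfl
      · exact hb hza
      · exact hb (by rw [comm_apply hz, hza])
      · exact hb (by rw [comm_apply hz, comm_apply hz, hza])
    obtain ⟨t, ht⟩ := hmem
    refine commute_of_perfect hc hs hP (alternatingGroup.ofSubtype s) (fun u => ?_) t ht.symm
    have hu := (alternatingGroup.mem_range_ofSubtype_iff s _).1 ⟨u, rfl⟩
    refine Subtype.ext (Equiv.Perm.Disjoint.commute (f := (alternatingGroup.ofSubtype s u).1) ?_).eq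
    rw [disjoint_iff_disjoint_support]
    exact Finset.disjoint_of_subset_left hu disjoint_compl_left
  have hxa : (π y : Equiv.Perm α) ((π x : Equiv.Perm α) a) ≠ (π x : Equiv.Perm α) a := by
    rw [← comm_apply hxy]
    exact fun h => ha ((π x : Equiv.Perm α).injective h)
  -- An element of the centralizer sends `a` to a point of its cycle; a power of `y` brings it back,
  -- which reduces to the case where `a` is fixed.
  have comm_pow (i : ℕ) (h : (π x : Equiv.Perm α) a = ((π y : Equiv.Perm α) ^ i) a) :
      Commute x y := by
    have h1 := key ((y ^ i)⁻¹ * x)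
      (by rw [map_mul, map_inv, map_pow]; exact ((Commute.refl _).pow_left i).inv_left.mul_left hxy)
      (by
        rw [map_mul, map_inv, map_pow]
        change ((π y : Equiv.Perm α) ^ i)⁻¹ ((π x : Equiv.Perm α) a) = a
        rw [Equiv.Perm.inv_eq_iff_eq, h])
    have h2 := (((Commute.refl y).pow_left i)).mul_left h1
    rwa [mul_inv_cancel_left] at h2
  rcases hy.eq_or_eq_or_eq ha hxa with h | h | h
  · exact comm_pow 0 h
  · exact comm_pow 1 h
  · exact comm_pow 2 h

omit [Fintype α] in
theorem swap_mul_swap_products {x y z w : α} (hxy : x ≠ y) (hxz : x ≠ z) (hyz : y ≠ z) :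
    Equiv.swap x y * Equiv.swap y z * (Equiv.swap x y * Equiv.swap y w) =
      Equiv.swap x z * Equiv.swap y w := by
  ext q
  simp only [Equiv.Perm.mul_apply, Equiv.swap_apply_def]
  grind

omit [Fintype α] in
theorem conj_swap_mul_swap (a : Equiv.Perm α) (x y z w : α) :
    a * (Equiv.swap x z * Equiv.swap y w) * a⁻¹ =
      Equiv.swap (a x) (a z) * Equiv.swap (a y) (a w) := by
  rw [Equiv.swap_apply_apply, Equiv.swap_apply_apply]
  group

/-- A perfect central extension of the alternating group of degree `5` or at least `8` is trivial if
the double transpositions on four points have commuting lifts. -/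
theorem injective_of_commute (hc : π.ker ≤ Subgroup.center E) (hs : Function.Surjective π)
    (hα : Nat.card α = 5 ∨ 8 ≤ Nat.card α) (hE : commutator E = ⊤)
    (hcomm : ∀ x y z w : α, x ≠ y → x ≠ z → x ≠ w → y ≠ z → y ≠ w → z ≠ w → ∀ d d' : E,
      (π d : Equiv.Perm α) = Equiv.swap x z * Equiv.swap y w →
      (π d' : Equiv.Perm α) = Equiv.swap x y * Equiv.swap z w → Commute d d') :
    Function.Injective π := by
  set T : Set E := {e | (π e : Equiv.Perm α).IsThreeCycle ∧ RealCubeLift e} with hT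
  have hinv : ∀ e ∈ T, e⁻¹ ∈ T := fun e he => ⟨by rw [map_inv]; exact he.1.inv, he.2.inv⟩
  have hconj (c : E) {e : E} (he : e ∈ T) : c * e * c⁻¹ ∈ T := by
    refine ⟨?_, he.2.conj c⟩
    rw [map_mul, map_mul, map_inv]
    exact (cycleType_conj (σ := (π e : Equiv.Perm α)) (τ := (π c : Equiv.Perm α))).trans he.1
  have hinj {e f : E} (he : e ∈ T) (hf : f ∈ T) (h : π e = π f) : e = f :=
    he.2.eq_of_map_eq hc hf.2 h fun _ hx => commute_of_isThreeCycle hc hs hα he.1 hx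
  have hex (σ : Equiv.Perm α) (hσ : σ.IsThreeCycle) : ∃ e ∈ T, (π e : Equiv.Perm α) = σ := by
    have hσ' : (⟨σ, hσ.mem_alternatingGroup⟩ : alternatingGroup α) ^ 3 = 1 :=
      Subtype.ext (by rw [SubgroupClass.coe_pow, ← hσ.orderOf, pow_orderOf_eq_one]; rfl)
    obtain ⟨γ, hγ⟩ := isConj_iff.1 (alternatingGroup.isThreeCycle_isConj (by omega)
      (σ := ⟨σ, hσ.mem_alternatingGroup⟩) (τ := ⟨σ, hσ.mem_alternatingGroup⟩⁻¹) hσ hσ.inv)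
    obtain ⟨e, he, heσ⟩ := exists_realCubeLift hc hs hσ' hγ
    exact ⟨e, ⟨by rwa [heσ], he⟩, by rw [heσ]⟩
  have hmul (e : E) (he : e ∈ T) (f : E) (hf : f ∈ T) (x : α) (hfx : (π f : Equiv.Perm α) x ≠ x)
      (hef : (π e : Equiv.Perm α) ((π f : Equiv.Perm α) x) = x) : e * f = 1 ∨ e * f ∈ T := by
    -- With `A` over `x ↦ y ↦ z` and `f` over `x ↦ y ↦ w`, the case `z = w` gives `A = f`. Otherwise
    -- `A * f` lies over `(x z)(y w)` and its conjugate by `A` over `(x y)(z w)`, whose lifts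
    -- commute by `hcomm`.
    obtain ⟨A, rfl⟩ : ∃ A, e = A⁻¹ := ⟨e⁻¹, by rw [inv_inv]⟩
    have hA : A ∈ T := by simpa using hinv _ he
    have hab : (π A : Equiv.Perm α) x = (π f : Equiv.Perm α) x := by
      rw [map_inv] at hef
      exact (Equiv.Perm.inv_eq_iff_eq.1 hef).symm
    have hax : (π A : Equiv.Perm α) x ≠ x := by rwa [hab]
    have ea := hA.1.eq_swap_mul_swap_iff_mem_support.2 (mem_support.2 hax)
    have eb := hf.1.eq_swap_mul_swap_iff_mem_support.2 (mem_support.2 hfx)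
    have na := hA.1.nodup_iff_mem_support.2 (mem_support.2 hax)
    have nb := hf.1.nodup_iff_mem_support.2 (mem_support.2 hfx)
    have a3 := hA.1.apply_apply_apply x
    rw [← hab] at eb nb
    simp only [List.nodup_cons, List.mem_cons, List.not_mem_nil, or_false, not_or] at na nb
    by_cases hzw : (π A : Equiv.Perm α) ((π A : Equiv.Perm α) x) =
        (π f : Equiv.Perm α) ((π A : Equiv.Perm α) x)
    · left
      rw [inv_mul_eq_one]
      exact hinj hA hf (Subtype.ext (by rw [ea, eb, hzw]))
    right
    have had : (π (A * f) : Equiv.Perm α) = Equiv.swap x ((π A : Equiv.Perm α) ((π A : Equiv.Perm α) x)) *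
        Equiv.swap ((π A : Equiv.Perm α) x) ((π f : Equiv.Perm α) ((π A : Equiv.Perm α) x)) := by
      rw [map_mul, Subgroup.coe_mul]
      conv_lhs => rw [ea, eb]
      exact swap_mul_swap_products na.1.1 na.1.2 na.2.1
    have haw : (π A : Equiv.Perm α) ((π f : Equiv.Perm α) ((π A : Equiv.Perm α) x)) =
        (π f : Equiv.Perm α) ((π A : Equiv.Perm α) x) := by
      refine (DFunLike.congr_fun ea _).trans ?_
      rw [Equiv.Perm.mul_apply, Equiv.swap_apply_of_ne_of_ne (Ne.symm nb.2.1) (Ne.symm hzw),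
        Equiv.swap_apply_of_ne_of_ne (Ne.symm nb.1.2) (Ne.symm nb.2.1)]
    have hsq : π A * π f * (π A * π f) = 1 := by
      rw [← map_mul]
      refine Subtype.ext ?_
      rw [Subgroup.coe_mul, had, (Equiv.Perm.disjoint_swap_swap (by
        simp only [List.nodup_cons, List.mem_cons, List.not_mem_nil, or_false, not_or]
        grind)).commute.symm.mul_mul_mul_comm, Equiv.swap_mul_self, Equiv.swap_mul_self]
      rfl
    have had' : (π (A * (A * f) * A⁻¹) : Equiv.Perm α) =
        Equiv.swap x ((π A : Equiv.Perm α) x) *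
          Equiv.swap ((π A : Equiv.Perm α) ((π A : Equiv.Perm α) x))
            ((π f : Equiv.Perm α) ((π A : Equiv.Perm α) x)) := by
      rw [map_mul, map_mul, map_inv, Subgroup.coe_mul, Subgroup.coe_mul, Subgroup.coe_inv, had,
        conj_swap_mul_swap, a3, haw, Equiv.swap_comm x]
    have hconjf : A * (A * f) * A⁻¹ * A⁻¹ * (A * (A * f) * A⁻¹)⁻¹ = f := by
      refine hinj (hconj _ he) hf ?_
      simp only [map_mul, map_inv]
      exact conj_eq_of_mul_sq_eq_one (by rw [← map_pow, hA.2.1, map_one])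
        (by rw [← map_pow, hf.2.1, map_one]) hsq
    rw [inv_mul_eq_conj_of_commute hA.2.1 (hcomm _ _ _ _ na.1.1 na.1.2 nb.1.2 na.2.1 nb.2.1 hzw
      _ _ had had') hconjf hf.2.1]
    exact hconj f hA
  have hT1 (e : E) := eq_one_of_mem_closure_of_map_eq_one ((alternatingGroup α).subtype.comp π) T hinv
    (fun e _ f hf => hconj e hf) (fun e he => he.1)
    (fun e he => by rw [← he.2.1, pow_succ, pow_two]) hex hmul (h := e)
  have hmap : (Subgroup.closure T).map π = ⊤ := by
    rw [eq_top_iff, ← alternatingGroup.closure_isThreeCycles_eq_top, Subgroup.closure_le]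
    intro σ hσ
    obtain ⟨e, he, heσ⟩ := hex σ hσ
    exact ⟨e, Subgroup.subset_closure he, Subtype.ext heσ⟩
  -- The closure maps onto the alternating group, so it contains all commutators of `E`, and `E` is
  -- perfect.
  have htop : Subgroup.closure T = ⊤ := by
    rw [eq_top_iff, ← hE, commutator_def, Subgroup.commutator_le]
    intro a _ b _
    obtain ⟨a', ha', ha⟩ : π a ∈ (Subgroup.closure T).map π := by rw [hmap]; trivial
    obtain ⟨b', hb', hb⟩ : π b ∈ (Subgroup.closure T).map π := by rw [hmap]; trivial
    rw [← ExtSquare.commutator_eq_of_central hc ha hb, commutatorElement_def]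
    exact mul_mem (mul_mem (mul_mem ha' hb') (inv_mem ha')) (inv_mem hb')
  rw [injective_iff_map_eq_one]
  intro e he
  exact hT1 e (by rw [htop]; trivial) (by simp [he])

end AlternatingExtensions

/-! ### Quotients of the exterior square, and abelian-by-cyclic groups. -/

namespace ExtSquare

variable {G : Type*} [Group G]

theorem ker_comm_le_of_quotient {N : Subgroup (ExtSquare G)} (hN : N ≤ (comm G).ker) [N.Normal]
    (h : Function.Injective (QuotientGroup.lift N (comm G) hN)) : (comm G).ker ≤ N := by
  intro w hw
  rw [← QuotientGroup.eq_one_iff]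
  apply h
  rw [map_one]
  exact hw

theorem normal_of_le_ker {N : Subgroup (ExtSquare G)} (hN : N ≤ (comm G).ker) : N.Normal :=
  ⟨fun n hn g => by
    rw [← (commute_of_comm_eq_one (MonoidHom.mem_ker.1 (hN hn)) g).eq, mul_inv_cancel_right]
    exact hn⟩

theorem ker_lift_le_center {N : Subgroup (ExtSquare G)} (hN : N ≤ (comm G).ker) [N.Normal] :
    (QuotientGroup.lift N (comm G) hN).ker ≤ Subgroup.center (ExtSquare G ⧸ N) := by
  intro w hw
  induction w using QuotientGroup.induction_on with
  | H w =>
    rw [Subgroup.mem_center_iff]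
    intro z
    induction z using QuotientGroup.induction_on with
    | H z =>
      rw [← QuotientGroup.mk_mul, ← QuotientGroup.mk_mul, (commute_of_comm_eq_one hw z).eq]

theorem commutator_quotient_eq_top (h : commutator G = ⊤) (N : Subgroup (ExtSquare G)) [N.Normal] :
    commutator (ExtSquare G ⧸ N) = ⊤ := by
  have : Group.IsPerfect (ExtSquare G) := ⟨commutator_eq_top h⟩
  exact Group.IsPerfect.commutator_eq_top

/-- The kernel of the commutator map for the extension of a cyclic group by an abelian group on
which the generator acts without fixed points. -/
theorem ker_comm_le_of_abelian_by_cyclic {N : Subgroup (ExtSquare G)} (hN : N ≤ (comm G).ker)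
    (V : Subgroup G) [V.Normal] (c : G) (hV : ∀ x ∈ V, ∀ y ∈ V, Commute x y)
    (hVN : ∀ x ∈ V, ∀ y ∈ V, wedge x y ∈ N) (hG : ∀ g : G, ∃ u ∈ V, ∃ i : ℕ, g = u * c ^ i)
    (hfix : ∀ u ∈ V, Commute c u → u = 1) : (comm G).ker ≤ N := by
  have hcen {z : ExtSquare G} (hz : z ∈ N) (w : ExtSquare G) : Commute z w :=
    commute_of_comm_eq_one (hN hz) w
  have hact {z : ExtSquare G} (hz : z ∈ N) (g : G) : act g z = z := act_of_comm_eq_one g (hN hz)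
  -- The choice of `u'` makes `u = u'⁻¹ * ⁅u', c⁆`. As `u'` commutes with `w`, acting by it replaces
  -- `c` with `⁅u', c⁆ * c`, and expanding leaves an error term in `V ∧ V`.
  have act_V {u w : G} (hu : u ∈ V) (hw : w ∈ V) : ∃ z ∈ N, act u (wedge c w) = wedge c w * z := by
    set u' := c⁻¹ * u⁻¹ * c with hu'
    have hu'V : u' ∈ V := by
      have := Subgroup.Normal.conj_mem ‹V.Normal› u⁻¹ (inv_mem hu) c⁻¹
      rwa [inv_inv] at this
    have hcV : ⁅u', c⁆ ∈ V := by
      rw [commutatorElement_def, mul_assoc, mul_assoc, ← mul_assoc c]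
      exact mul_mem hu'V (Subgroup.Normal.conj_mem ‹V.Normal› _ (inv_mem hu'V) c)
    have h1 : act u' (wedge c w) = act ⁅u', c⁆ (wedge c w) * wedge ⁅u', c⁆ w := by
      rw [← wedge_mul_left, act_wedge, (hV u' hu'V w hw).eq, mul_inv_cancel_right,
        commutatorElement_def, inv_mul_cancel_right]
    have h2 := congrArg (act u'⁻¹) h1
    rw [← act_mul, inv_mul_cancel, act_one, map_mul, ← act_mul, hact (hVN _ hcV _ hw)] at h2
    rw [show u'⁻¹ * ⁅u', c⁆ = u by rw [hu', commutatorElement_def]; group] at h2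
    exact ⟨_, inv_mem (hVN _ hcV _ hw), eq_mul_inv_of_mul_eq h2.symm⟩
  have mul_V {u w : G} (hu : u ∈ V) (hw : w ∈ V) :
      ∃ z ∈ N, wedge c (u * w) = wedge c u * wedge c w * z := by
    obtain ⟨z, hz, h⟩ := act_V hu hw
    exact ⟨z, hz, by rw [wedge_mul_right, h, mul_assoc]⟩
  -- Modulo `N`, the map `u ↦ c ∧ u` is a homomorphism on `V`; it turns out to be onto. A kernel
  -- element `(c ∧ u) z` then has `⁅c, u⁆ = 1`, so `hfix` applies.
  let S : Subgroup (ExtSquare G) :=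
    { carrier := {w | ∃ u ∈ V, ∃ z ∈ N, w = wedge c u * z}
      one_mem' := ⟨1, one_mem _, 1, one_mem _, by simp⟩
      mul_mem' := by
        rintro _ _ ⟨u, hu, z, hz, rfl⟩ ⟨u', hu', z', hz', rfl⟩
        obtain ⟨y, hy, h⟩ := mul_V hu hu'
        refine ⟨u * u', mul_mem hu hu', y⁻¹ * (z * z'), mul_mem (inv_mem hy) (mul_mem hz hz'), ?_⟩
        rw [h, (hcen hz _).mul_mul_mul_comm]
        group
      inv_mem' := by
        rintro _ ⟨u, hu, z, hz, rfl⟩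
        obtain ⟨y, hy, h⟩ := mul_V hu (inv_mem hu)
        rw [mul_inv_cancel, wedge_one_right, mul_assoc, eq_comm, ← eq_inv_iff_mul_eq_one,
          eq_inv_iff_mul_eq_one, ← inv_eq_iff_mul_eq_one] at h
        refine ⟨u⁻¹, inv_mem hu, y * z⁻¹, mul_mem hy (inv_mem hz), ?_⟩
        rw [mul_inv_rev, h, (hcen hz _).inv_left.eq, mul_assoc] }
  have hNS : N ≤ S := fun z hz => ⟨1, one_mem _, z, hz, by simp⟩
  have hcS {u : G} (hu : u ∈ V) : wedge c u ∈ S := ⟨u, hu, 1, one_mem _, by simp⟩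
  have hSV {u : G} (hu : u ∈ V) {w : ExtSquare G} (hw : w ∈ S) : act u w ∈ S := by
    obtain ⟨u', hu', z, hz, rfl⟩ := hw
    obtain ⟨y, hy, h⟩ := act_V hu hu'
    rw [map_mul, h, hact hz]
    exact mul_mem (mul_mem (hcS hu') (hNS hy)) (hNS hz)
  have hSc {w : ExtSquare G} (hw : w ∈ S) : act c w ∈ S := by
    obtain ⟨u', hu', z, hz, rfl⟩ := hw
    rw [map_mul, hact hz, act_wedge, mul_inv_cancel_right]
    exact mul_mem (hcS (Subgroup.Normal.conj_mem ‹V.Normal› _ hu' c)) (hNS hz)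
  have hpow {u : G} (hu : u ∈ V) (i : ℕ) : wedge (c ^ i) u ∈ S := by
    induction i with
    | zero => rw [pow_zero, wedge_one_left]; exact one_mem _
    | succ i ih => rw [pow_succ', wedge_mul_left]; exact mul_mem (hSc ih) (hcS hu)
  have hcc (j : ℕ) : wedge c (c ^ j) = 1 := by
    induction j with
    | zero => simp
    | succ j ih => rw [pow_succ', wedge_mul_right, ih]; simp
  have hpp (i j : ℕ) : wedge (c ^ i) (c ^ j) = 1 := by
    induction i with
    | zero => simp
    | succ i ih => rw [pow_succ', wedge_mul_left, ih, hcc]; simp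
  have hxu (x : G) {u : G} (hu : u ∈ V) : wedge x u ∈ S := by
    obtain ⟨u', hu', i, rfl⟩ := hG x
    rw [wedge_mul_left]
    exact mul_mem (hSV hu' (hpow hu i)) (hNS (hVN _ hu' _ hu))
  have htop : S = ⊤ := by
    rw [eq_top_iff, ← closure_wedge, Subgroup.closure_le]
    rintro _ ⟨x, y, rfl⟩
    obtain ⟨u, hu, i, rfl⟩ := hG x
    rw [wedge_mul_left, wedge_swap u]
    refine mul_mem (hSV hu ?_) (inv_mem (hxu y hu))
    obtain ⟨u', hu', j, rfl⟩ := hG y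
    rw [wedge_mul_right, hpp, map_one, mul_one]
    exact hpow hu' i
  intro w hw
  obtain ⟨u, hu, z, hz, rfl⟩ : w ∈ S := by rw [htop]; trivial
  have hw' : ⁅c, u⁆ = 1 := by
    rw [MonoidHom.mem_ker, map_mul, MonoidHom.mem_ker.1 (hN hz), mul_one, comm_wedge] at hw
    exact hw
  rw [hfix u hu (commutatorElement_eq_one_iff_commute.1 hw'), wedge_one_right, one_mul]
  exact hz

end ExtSquare

/-! ### The Klein four-group. -/

section Klein

/-- The Klein four-group in `A_4`. -/
def kleinA4 : Subgroup (alternatingGroup (Fin 4)) where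
  carrier := {g | g * g = 1}
  one_mem' := one_mul 1
  mul_mem' {x y} hx hy := by
    have : ∀ x y : Equiv.Perm (Fin 4), Equiv.Perm.sign x = 1 → Equiv.Perm.sign y = 1 →
      x * x = 1 → y * y = 1 → x * y * (x * y) = 1 := by decide +kernel
    exact Subtype.ext (this x y x.2 y.2 (congrArg Subtype.val hx) (congrArg Subtype.val hy))
  inv_mem' {x} hx := by
    change x⁻¹ * x⁻¹ = 1
    rw [← mul_inv_rev, inv_eq_one]
    exact hx

instance : kleinA4.Normal :=
  ⟨fun n hn g => by
    change n * n = 1 at hn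
    change g * n * g⁻¹ * (g * n * g⁻¹) = 1
    rw [conj_mul, hn]
    simp⟩

end Klein

/-! ### Generation of the multiplier of `A_n` and the final assembly. -/

section

open ExtSquare

variable {n : ℕ} (hn : 4 ≤ n)

theorem zpowers_wedge_dbl_le_ker :
    Subgroup.zpowers (wedge (dblA hn) (dblB hn)) ≤ (comm (alternatingGroup (Fin n))).ker := by
  rw [Subgroup.zpowers_le, MonoidHom.mem_ker, comm_wedge]
  exact commutatorElement_eq_one_iff_commute.2 (dbl_commute hn)

theorem ker_comm_le_zpowers_four (hn : 4 ≤ 4) :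
    (comm (alternatingGroup (Fin 4))).ker ≤
      Subgroup.zpowers (wedge (dblA hn) (dblB hn)) := by
  have hmem : ∀ x ∈ kleinA4, x = 1 ∨ x = dblA hn ∨ x = dblB hn ∨ x = dblA hn * dblB hn := by
    intro x hx
    have key : ∀ x : Equiv.Perm (Fin 4), Equiv.Perm.sign x = 1 → x * x = 1 →
        x = 1 ∨ x = Equiv.swap 0 1 * Equiv.swap 2 3 ∨ x = Equiv.swap 0 2 * Equiv.swap 1 3 ∨
          x = Equiv.swap 0 1 * Equiv.swap 2 3 * (Equiv.swap 0 2 * Equiv.swap 1 3) := by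
      decide +kernel
    rcases key x x.2 (congrArg Subtype.val hx) with h | h | h | h
    · exact Or.inl (Subtype.ext h)
    · exact Or.inr (Or.inl (Subtype.ext h))
    · exact Or.inr (Or.inr (Or.inl (Subtype.ext h)))
    · exact Or.inr (Or.inr (Or.inr (Subtype.ext h)))
  have hV : ∀ x ∈ kleinA4, ∀ y ∈ kleinA4, Commute x y := by
    intro x hx y hy
    have hxy : x * y * (x * y) = 1 := mul_mem hx hy
    rw [← eq_inv_iff_mul_eq_one, mul_inv_rev, inv_eq_of_mul_eq_one_left (show x * x = 1 from hx),
      inv_eq_of_mul_eq_one_left (show y * y = 1 from hy)] at hxy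
    exact hxy
  have ha : dblA hn ∈ kleinA4 := dblA_mul_self hn
  have hb : dblB hn ∈ kleinA4 := by
    refine Subtype.ext ?_
    change (Equiv.swap 0 2 * Equiv.swap 1 3 * (Equiv.swap 0 2 * Equiv.swap 1 3) :
      Equiv.Perm (Fin 4)) = 1
    decide
  have act_wedge_V {x y : alternatingGroup (Fin 4)} (g : alternatingGroup (Fin 4))
      (hx : x ∈ kleinA4) (hy : y ∈ kleinA4) : act g (wedge x y) = wedge x y :=
    act_of_comm_eq_one g (by
      rw [comm_wedge]; exact commutatorElement_eq_one_iff_commute.2 (hV x hx y hy))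
  have hv := Subgroup.mem_zpowers (wedge (dblA hn) (dblB hn))
  let c : alternatingGroup (Fin 4) :=
    ⟨Equiv.swap 0 1 * Equiv.swap 1 2, Equiv.Perm.mem_alternatingGroup.2 (by decide)⟩
  refine ker_comm_le_of_abelian_by_cyclic (zpowers_wedge_dbl_le_ker hn) kleinA4
    c hV ?_ ?_ ?_
  · have hA (y : alternatingGroup (Fin 4)) (hy : y ∈ kleinA4) :
        wedge (dblA hn) y ∈ Subgroup.zpowers (wedge (dblA hn) (dblB hn)) := by
      rcases hmem y hy with rfl | rfl | rfl | rfl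
      · simp
      · simp
      · exact hv
      · rw [wedge_mul_right, act_wedge_V _ ha hb, wedge_self, one_mul]
        exact hv
    have hB (y : alternatingGroup (Fin 4)) (hy : y ∈ kleinA4) :
        wedge (dblB hn) y ∈ Subgroup.zpowers (wedge (dblA hn) (dblB hn)) := by
      rcases hmem y hy with rfl | rfl | rfl | rfl
      · simp
      · rw [wedge_swap (dblB hn)]
        exact inv_mem hv
      · simp
      · rw [wedge_mul_right, wedge_self, map_one, mul_one, wedge_swap (dblB hn)]
        exact inv_mem hv
    intro x hx y hy
    rcases hmem x hx with rfl | rfl | rfl | rfl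
    · simp
    · exact hA y hy
    · exact hB y hy
    · rw [wedge_mul_left, act_wedge_V _ hb hy]
      exact mul_mem (hB y hy) (hA y hy)
  · have key : ∀ g : Equiv.Perm (Fin 4), Equiv.Perm.sign g = 1 → g * g = 1 ∨
        g * (Equiv.swap 0 1 * Equiv.swap 1 2) * (g * (Equiv.swap 0 1 * Equiv.swap 1 2)) = 1 ∨
        g * (Equiv.swap 0 1 * Equiv.swap 1 2 * (Equiv.swap 0 1 * Equiv.swap 1 2)) *
          (g * (Equiv.swap 0 1 * Equiv.swap 1 2 * (Equiv.swap 0 1 * Equiv.swap 1 2))) = 1 := by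
      decide +kernel
    have hc3 : c ^ 3 = 1 := Subtype.ext
      (show (Equiv.swap 0 1 * Equiv.swap 1 2 : Equiv.Perm (Fin 4)) ^ 3 = 1 by decide)
    intro g
    rcases key g g.2 with h | h | h
    · exact ⟨g, Subtype.ext h, 0, by simp⟩
    · exact ⟨g * c, Subtype.ext h, 2, by rw [mul_assoc, ← pow_succ', hc3, mul_one]⟩
    · exact ⟨g * (c * c), Subtype.ext h, 1, by rw [mul_assoc, ← pow_two, ← pow_add, hc3, mul_one]⟩
  · intro u hu hcu
    have key : ∀ u : Equiv.Perm (Fin 4), u * u = 1 →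
        Equiv.swap 0 1 * Equiv.swap 1 2 * u = u * (Equiv.swap 0 1 * Equiv.swap 1 2) → u = 1 := by
      decide +kernel
    exact Subtype.ext (key u (congrArg Subtype.val hu) (congrArg Subtype.val hcu.eq))

/-- In the extension of `A_n` by the class of `(1,2)(3,4) ∧ (1,3)(2,4)`, the double transpositions on
any four points have commuting lifts. -/
theorem commute_lifts_of_dbl {E : Type*} [Group E] {π : E →* alternatingGroup (Fin n)}
    (hc : π.ker ≤ Subgroup.center E) {a b : E} (ha : π a = dblA hn) (hb : π b = dblB hn)
    (hab : Commute a b) (hs : Function.Surjective π) {x y z w : Fin n} (hxy : x ≠ y) (hxz : x ≠ z)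
    (hxw : x ≠ w) (hyz : y ≠ z) (hyw : y ≠ w) (hzw : z ≠ w) {d d' : E}
    (hd : (π d : Equiv.Perm (Fin n)) = Equiv.swap x z * Equiv.swap y w)
    (hd' : (π d' : Equiv.Perm (Fin n)) = Equiv.swap x y * Equiv.swap z w) : Commute d d' := by
  have aux (σ : Equiv.Perm (Fin n)) (hσ : Equiv.Perm.sign σ = 1) (d d' : E)
      (hd : (π d : Equiv.Perm (Fin n)) = σ * dblA hn * σ⁻¹)
      (hd' : (π d' : Equiv.Perm (Fin n)) = σ * dblB hn * σ⁻¹) : Commute d d' := by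
    obtain ⟨g, hg⟩ := hs ⟨σ, hσ⟩
    have h1 : π d = π (g * a * g⁻¹) := Subtype.ext (by
      rw [map_mul, map_mul, map_inv, hg, ha, hd]; rfl)
    have h2 : π d' = π (g * b * g⁻¹) := Subtype.ext (by
      rw [map_mul, map_mul, map_inv, hg, hb, hd']; rfl)
    rw [← commutatorElement_eq_one_iff_commute, commutator_eq_of_central hc h1 h2,
      commutatorElement_eq_one_iff_commute]
    have := hab.map (MulAut.conj g)
    simpa using this
  have hconj (σ : Equiv.Perm (Fin n)) (i j k l : Fin 4) :
      σ * (transp hn i j * transp hn k l) * σ⁻¹ =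
        Equiv.swap (σ (Fin.castLE hn i)) (σ (Fin.castLE hn j)) *
          Equiv.swap (σ (Fin.castLE hn k)) (σ (Fin.castLE hn l)) :=
    conj_swap_mul_swap σ _ _ _ _
  obtain ⟨σ, hσ⟩ := Equiv.Perm.exists_extending_pair (Fin.castLE hn) ![x, z, y, w]
    (Fin.castLE_injective hn) (by
      intro i j hij
      fin_cases i <;> fin_cases j <;> simp_all [eq_comm])
  have h0 : σ (Fin.castLE hn 0) = x := hσ 0
  have h1 : σ (Fin.castLE hn 1) = z := hσ 1
  have h2 : σ (Fin.castLE hn 2) = y := hσ 2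
  have h3 : σ (Fin.castLE hn 3) = w := hσ 3
  rcases Int.units_eq_one_or (Equiv.Perm.sign σ) with hs1 | hs1
  · refine aux σ hs1 d d' ?_ ?_
    · rw [hd, dblA, hconj, h0, h1, h2, h3]
    · rw [hd', dblB, hconj, h0, h1, h2, h3]
  -- Swapping the two middle points makes an odd `σ` even and interchanges the two double
  -- transpositions.
  · refine (aux (σ * transp hn 1 2) ?_ d' d ?_ ?_).symm
    · rw [map_mul, hs1, transp, Equiv.Perm.sign_swap (by simp)]
      decide
    all_goals
      have e0 : (σ * transp hn 1 2) (Fin.castLE hn 0) = x := by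
        rw [Equiv.Perm.mul_apply, transp, Equiv.swap_apply_of_ne_of_ne (by simp) (by simp), h0]
      have e1 : (σ * transp hn 1 2) (Fin.castLE hn 1) = y := by
        rw [Equiv.Perm.mul_apply, transp, Equiv.swap_apply_left, h2]
      have e2 : (σ * transp hn 1 2) (Fin.castLE hn 2) = z := by
        rw [Equiv.Perm.mul_apply, transp, Equiv.swap_apply_right, h1]
      have e3 : (σ * transp hn 1 2) (Fin.castLE hn 3) = w := by
        rw [Equiv.Perm.mul_apply, transp, Equiv.swap_apply_of_ne_of_ne (by simp) (by simp), h3]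
    · rw [hd', dblA, hconj, e0, e1, e2, e3]
    · rw [hd, dblB, hconj, e0, e1, e2, e3]

theorem ker_comm_le_zpowers (h6 : n ≠ 6) (h7 : n ≠ 7) :
    (comm (alternatingGroup (Fin n))).ker ≤
      Subgroup.zpowers (wedge (dblA hn) (dblB hn)) := by
  rcases hn.eq_or_lt with rfl | hn5
  · exact ker_comm_le_zpowers_four hn
  have hcard : Nat.card (Fin n) = n := by simp
  have hperf : commutator (alternatingGroup (Fin n)) = ⊤ :=
    commutator_alternatingGroup_eq_top_of_card _ (by omega)
  have hN := zpowers_wedge_dbl_le_ker hn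
  have := normal_of_le_ker hN
  have hcen := ker_lift_le_center hN
  have hsurj : Function.Surjective (QuotientGroup.lift _ (comm (alternatingGroup (Fin n))) hN) :=
    QuotientGroup.lift_surjective_of_surjective _ _ (comm_surjective hperf) _
  refine ker_comm_le_of_quotient hN (injective_of_commute hcen hsurj (by omega)
    (commutator_quotient_eq_top hperf _) ?_)
  intro x y z w hxy hxz hxw hyz hyw hzw d d' hd hd'
  obtain ⟨a, ha⟩ := comm_surjective hperf (dblA hn)
  obtain ⟨b, hb⟩ := comm_surjective hperf (dblB hn)
  refine commute_lifts_of_dbl hn hcen (a := QuotientGroup.mk a) (b := QuotientGroup.mk b) ha hb ?_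
    hsurj hxy hxz hxw hyz hyw hzw hd hd'
  -- The commutator of `a` and `b` in the exterior square is the generator of the subgroup divided
  -- out.
  rw [← commutatorElement_eq_one_iff_commute]
  have h := map_commutatorElement (QuotientGroup.mk' (Subgroup.zpowers (wedge (dblA hn) (dblB hn)))) a b
  rw [commutator_eq_wedge, ha, hb] at h
  refine h.symm.trans ?_
  exact (QuotientGroup.eq_one_iff _).2 (Subgroup.mem_zpowers _)

theorem map_altClass : SchurMultiplier.map (alternatingGroup (Fin n)).subtype (altClass hn) =
    schurClass (dblA hn : Equiv.Perm (Fin n)) (dblB hn : Equiv.Perm (Fin n))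
      ((dbl_commute hn).map (alternatingGroup (Fin n)).subtype) := by
  refine congrArg QuotientGroup.mk (Subtype.ext ?_)
  exact pairMap_pairGen _ _ _

theorem zpowers_altClass (h6 : n ≠ 6) (h7 : n ≠ 7) : Subgroup.zpowers (altClass hn) = ⊤ := by
  rw [eq_top_iff]
  rintro x -
  induction x using QuotientGroup.induction_on with
  | H x =>
    obtain ⟨w, hw⟩ := x
    obtain ⟨k, hk⟩ := ker_comm_le_zpowers hn h6 h7 (x := QuotientGroup.mk w) hw
    refine ⟨k, ?_⟩
    exact QuotientGroup.eq.2 (Subgroup.mem_subgroupOf.2 (QuotientGroup.eq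
      (a := pairGen (dblA hn) (dblB hn) ^ k).1 hk))

theorem altClass_mul_self : altClass hn * altClass hn = 1 := by
  have h := wedge_sq_eq_one (dblA_mul_self hn) (dbl_commute hn)
  exact (QuotientGroup.eq_one_iff _).2 (Subgroup.mem_subgroupOf.2 ((QuotientGroup.eq_one_iff
    (pairGen (dblA hn) (dblB hn) * pairGen (dblA hn) (dblB hn))).1 h))

end

theorem mainTheorem11 (n : ℕ) (hn : 4 ≤ n) :
    altClass hn ≠ 1 ∧
    schurClass (dblA hn : Equiv.Perm (Fin n)) (dblB hn : Equiv.Perm (Fin n))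
        ((dbl_commute hn).map (alternatingGroup (Fin n)).subtype) = uClass hn ∧
    SchurMultiplier.map (alternatingGroup (Fin n)).subtype (altClass hn) = uClass hn ∧
    uClass hn ≠ 1 ∧
    (n ≠ 6 → n ≠ 7 →
      Subgroup.zpowers (altClass hn) = ⊤ ∧
      Nonempty (SchurMultiplier (alternatingGroup (Fin n)) ≃* Multiplicative (ZMod 2))) := by
  have h2 : schurClass (dblA hn : Equiv.Perm (Fin n)) (dblB hn : Equiv.Perm (Fin n))
      ((dbl_commute hn).map (alternatingGroup (Fin n)).subtype) = uClass hn :=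
    (schurClass_eq_iff _ _).2 (wedge_dbl hn)
  have h3 := (map_altClass hn).trans h2
  have h4 := uClass_ne_one hn
  have h1 : altClass hn ≠ 1 := fun h => h4 (by rw [← h3, h, map_one])
  refine ⟨h1, h2, h3, h4, fun h6 h7 => ⟨zpowers_altClass hn h6 h7, ?_⟩⟩
  have hord : orderOf (altClass hn) = 2 :=
    orderOf_eq_prime (by rw [pow_two, altClass_mul_self]) h1
  have hgen : ∀ x, x ∈ Subgroup.zpowers (altClass hn) := fun x => by
    rw [zpowers_altClass hn h6 h7]; trivial
  exact ⟨(zmodMulEquivOfGenerator hgen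
    (by rw [← hord, orderOf_eq_card_of_forall_mem_zpowers hgen])).symm⟩
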